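/- Let $\Omega_1\subset\mathbb R^{N_1}$ and $\Omega_2\subset\mathbb R^{N_2}$ satisfy (B1): each $\Omega_i$ is a bounded region (non-empty, connected, open) whose boundary is the union of finitely many pairwise disjoint closed Lipschitz surfaces, each of finite surface area (finite $(N_i-1)$-dimensional Hausdorff measure). All functions are real. $H_0^1(\Omega)$ is the closure of $C_c^\infty(\Omega)$ in $H^1(\Omega)$, and $[u,v]_\nabla:=\int_\Omega\nabla u\cdot\nabla v\,dx$. A (weak) Dirichlet Laplacian eigenfunction on $\Omega$ with eigenvalue $\lambda\in\mathbb R$ is a nonzero $u\in H_0^1(\Omega)$ such that $$\int_\Omega\nabla u\cdot\nabla h\,dx=\lambda\int_\Omega u\,h\,dx\qquad\text{for all }h\in H_0^1(\Omega).$$ For $i=1,2$ let $(e_{ij})_{j\in\mathbb N}$ be a sequence of Dirichlet Laplacian eigenfunctions on $\Omega_i$, with eigenvalues $(\lambda_{ij})_{j\in\mathbb N}$, that is an orthonormal basis of $L^2(\Omega_i)$. For $j,k\in\mathbb N$ let $u_{jk}:=e_{1j}\otimes e_{2k}$ be the dyad $u_{jk}(x,y)=e_{1j}(x)\,e_{2k}(y)$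 on the product region $\Omega_p:=\Omega_1\times\Omega_2\subset\mathbb R^{N_1}\times\mathbb R^{N_2}$. Then: 1. each $u_{jk}$ is a Dirichlet Laplacian eigenfunction on $\Omega_p$ with eigenvalue $\lambda_{1j}+\lambda_{2k}$; 2. $\{u_{jk}: j,k\in\mathbb N\}$ is an orthonormal basis of $L^2(\Omega_p)$; 3. $\{(\lambda_{1j}+\lambda_{2k})^{-1/2}u_{jk}: j,k\in\mathbb N\}$ is an orthonormal basis of $H_0^1(\Omega_p)$ with respect to $[\cdot,\cdot]_\nabla$, and the Fourier series of each $h\in H_0^1(\Omega_p)$ in it converges to $h$ in $H^1(\Omega_p)$; 4. for every $\lambda\in\mathbb R$, every Dirichlet Laplacian eigenfunction on $\Omega_p$ with eigenvalue $\lambda$ is a finite linear combination of those $u_{jk}$ with $\lambda_{1j}+\lambda_{2k}=\lambda$. -/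

import Mathlib

open MeasureTheory
open scoped RealInnerProductSpace ContDiff

namespace ProductDirichlet

/-! ### Regions -/

/-- A Lipschitz hypersurface: near each of its points `p` it is the graph, in some direction `ν`, of
a Lipschitz function `γ` of the component `x - ⟪ν, x⟫ ν` of `x` orthogonal to `ν`. -/
def IsLipschitzSurface {E : Type*} [NormedAddCommGroup E] [InnerProductSpace ℝ E]
    (S : Set E) : Prop :=
  ∀ p ∈ S, ∃ ν : E, ‖ν‖ = 1 ∧ ∃ (K : NNReal) (γ : E → ℝ), LipschitzWith K γ ∧
    ∃ r > 0, ∀ x ∈ Metric.ball p r, x ∈ S ↔ ⟪ν, x⟫ = γ (x - ⟪ν, x⟫ • ν)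

/-- Condition (B1): `Ω` is a bounded region (non-empty, connected, open) in `ℝ^N`, and its boundary
is the union of finitely many pairwise disjoint closed Lipschitz surfaces, each of finite
`(N - 1)`-dimensional Hausdorff measure. -/
structure B1 {N : ℕ} (Ω : Set (EuclideanSpace ℝ (Fin N))) : Prop where
  isOpen : IsOpen Ω
  isConnected : IsConnected Ω
  isBounded : Bornology.IsBounded Ω
  boundary : ∃ (m : ℕ) (S : Fin m → Set (EuclideanSpace ℝ (Fin N))),
    frontier Ω = ⋃ i, S i ∧
    Pairwise (fun i j => Disjoint (S i) (S j)) ∧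
    ∀ i, IsClosed (S i) ∧ IsLipschitzSurface (S i) ∧
      Measure.hausdorffMeasure ((N : ℝ) - 1) (S i) < ⊤

/-- The product region, inside the Euclidean (`ℓ²`) product of the two ambient spaces. Its volume is
the product of the two volumes (`WithLp.volume_preserving_ofLp`). -/
def prodRegion {E₁ E₂ : Type*} (Ω₁ : Set E₁) (Ω₂ : Set E₂) : Set (WithLp 2 (E₁ × E₂)) :=
  {z | z.fst ∈ Ω₁ ∧ z.snd ∈ Ω₂}

noncomputable section

/-! ### Sobolev spaces -/

section Sobolev

set_option linter.unusedSectionVars false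

variable {E : Type*} [NormedAddCommGroup E] [InnerProductSpace ℝ E] [FiniteDimensional ℝ E]
  [MeasurableSpace E] [BorelSpace E]

/-- The real space `L²(Ω)`, with Lebesgue measure. -/
abbrev L2 (Ω : Set E) : Type _ := Lp ℝ 2 (volume.restrict Ω)

/-- Square integrable vector fields on `Ω`. -/
abbrev L2Vec (Ω : Set E) : Type _ := Lp E 2 (volume.restrict Ω)

/-- Test functions: smooth, with compact support contained in `Ω`. -/
structure IsTestFunction (Ω : Set E) (φ : E → ℝ) : Prop where
  contDiff : ContDiff ℝ ∞ φ
  hasCompactSupport : HasCompactSupport φ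
  tsupport_subset : tsupport φ ⊆ Ω

/-- `g` is the weak gradient of `u` on `Ω`: `∫ u ∇φ = - ∫ φ g` for all test functions `φ`. -/
def IsWeakGradient (Ω : Set E) (u : L2 Ω) (g : L2Vec Ω) : Prop :=
  ∀ φ : E → ℝ, IsTestFunction Ω φ →
    ∫ x in Ω, u x • gradient φ x = - ∫ x in Ω, φ x • g x

lemma IsTestFunction.continuous_gradient {Ω : Set E} {φ : E → ℝ} (h : IsTestFunction Ω φ) :
    Continuous (gradient φ) :=
  (InnerProductSpace.toDual ℝ E).symm.continuous.comp (h.contDiff.continuous_fderiv (by simp))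

lemma IsTestFunction.hasCompactSupport_gradient {Ω : Set E} {φ : E → ℝ}
    (h : IsTestFunction Ω φ) : HasCompactSupport (gradient φ) :=
  (h.hasCompactSupport.fderiv ℝ).comp_left (g := (InnerProductSpace.toDual ℝ E).symm) (map_zero _)

lemma IsTestFunction.integrable_left {Ω : Set E} {φ : E → ℝ} (h : IsTestFunction Ω φ)
    (u : L2 Ω) : Integrable (fun x => u x • gradient φ x) (volume.restrict Ω) :=
  memLp_one_iff_integrable.mp (MemLp.smul (p := 2) (q := 2)
    ((h.continuous_gradient.memLp_of_hasCompactSupport h.hasCompactSupport_gradient).restrict Ω)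
    (Lp.memLp u))

lemma IsTestFunction.integrable_right {Ω : Set E} {φ : E → ℝ} (h : IsTestFunction Ω φ)
    (g : L2Vec Ω) : Integrable (fun x => φ x • g x) (volume.restrict Ω) :=
  memLp_one_iff_integrable.mp (MemLp.smul (p := 2) (q := 2) (Lp.memLp g)
    ((h.contDiff.continuous.memLp_of_hasCompactSupport h.hasCompactSupport).restrict Ω))

/-- The Sobolev space `H¹(Ω)`, as the space of pairs `(u, ∇u)` in `L² × L²`. The inner product it
inherits is `∫ (u v + ∇u · ∇v)`. -/
def H1 (Ω : Set E) : Submodule ℝ (WithLp 2 (L2 Ω × L2Vec Ω)) where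
  carrier := {p | IsWeakGradient Ω p.fst p.snd}
  zero_mem' := by
    intro φ _
    have h1 : ∫ x in Ω, (0 : L2 Ω) x • gradient φ x = 0 := by
      refine integral_eq_zero_of_ae ?_
      filter_upwards [Lp.coeFn_zero ℝ 2 (volume.restrict Ω)] with x hx
      rw [hx, Pi.zero_apply, zero_smul, Pi.zero_apply]
    have h2 : ∫ x in Ω, φ x • (0 : L2Vec Ω) x = 0 := by
      refine integral_eq_zero_of_ae ?_
      filter_upwards [Lp.coeFn_zero E 2 (volume.restrict Ω)] with x hx
      rw [hx, Pi.zero_apply, smul_zero]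
    rw [WithLp.zero_fst, WithLp.zero_snd, h1, h2, neg_zero]
  add_mem' := by
    intro p q hp hq φ hφ
    have h1 : ∫ x in Ω, (p.fst + q.fst) x • gradient φ x
        = ∫ x in Ω, (p.fst x • gradient φ x + q.fst x • gradient φ x) := by
      refine integral_congr_ae ?_
      filter_upwards [Lp.coeFn_add p.fst q.fst] with x hx
      rw [hx, Pi.add_apply, add_smul]
    have h2 : ∫ x in Ω, φ x • (p.snd + q.snd) x
        = ∫ x in Ω, (φ x • p.snd x + φ x • q.snd x) := by
      refine integral_congr_ae ?_
      filter_upwards [Lp.coeFn_add p.snd q.snd] with x hx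
      rw [hx, Pi.add_apply, smul_add]
    rw [WithLp.add_fst, WithLp.add_snd, h1, h2,
      integral_add (hφ.integrable_left _) (hφ.integrable_left _),
      integral_add (hφ.integrable_right _) (hφ.integrable_right _), hp φ hφ, hq φ hφ, neg_add]
  smul_mem' := by
    intro c p hp φ hφ
    have h1 : ∫ x in Ω, (c • p.fst) x • gradient φ x
        = ∫ x in Ω, c • (p.fst x • gradient φ x) := by
      refine integral_congr_ae ?_
      filter_upwards [Lp.coeFn_smul c p.fst] with x hx
      rw [hx, Pi.smul_apply, smul_assoc]
    have h2 : ∫ x in Ω, φ x • (c • p.snd) x = ∫ x in Ω, c • (φ x • p.snd x) := by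
      refine integral_congr_ae ?_
      filter_upwards [Lp.coeFn_smul c p.snd] with x hx
      rw [hx, Pi.smul_apply, smul_comm]
    rw [WithLp.smul_fst, WithLp.smul_snd, h1, h2, integral_smul, integral_smul, hp φ hφ, smul_neg]

/-- The function `u ∈ L²(Ω)` underlying an element of `H¹(Ω)`. -/
def toL2 {Ω : Set E} (u : H1 Ω) : L2 Ω := u.1.fst

/-- The weak gradient `∇u` of an element of `H¹(Ω)`. -/
def grad {Ω : Set E} (u : H1 Ω) : L2Vec Ω := u.1.snd

/-- The space `H₀¹(Ω)`: the closure in `H¹(Ω)` of the (linear space of classes of) test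
functions. -/
def H10 (Ω : Set E) : Submodule ℝ (H1 Ω) :=
  (Submodule.span ℝ {u : H1 Ω | ∃ φ : E → ℝ, IsTestFunction Ω φ ∧
    toL2 u =ᵐ[volume.restrict Ω] φ ∧
    grad u =ᵐ[volume.restrict Ω] gradient φ}).topologicalClosure

/-- The gradient form `[u, v]_∇ = ∫_Ω ∇u · ∇v`. -/
def gradInner {Ω : Set E} (u v : H1 Ω) : ℝ := ∫ x in Ω, ⟪grad u x, grad v x⟫

/-! ### The Dirichlet Laplacian eigenproblem -/

/-- `u` is a (weak) Dirichlet Laplacian eigenfunction on `Ω` with eigenvalue `lam`: it is a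
nontrivial element of `H₀¹(Ω)` with `∫ ∇u · ∇h = lam ∫ u h` for all `h ∈ H₀¹(Ω)`. -/
structure IsDirichletEigenfunction (Ω : Set E) (lam : ℝ) (u : H1 Ω) : Prop where
  mem_H10 : u ∈ H10 Ω
  ne_zero : toL2 u ≠ 0
  eigen : ∀ h ∈ H10 Ω, ∫ x in Ω, ⟪grad u x, grad h x⟫ = lam * ∫ x in Ω, toL2 u x * toL2 h x

/-- The family `u` is an orthonormal basis of `L²(Ω)`. -/
def IsL2OrthonormalBasis {ι : Type*} {Ω : Set E} (u : ι → H1 Ω) : Prop :=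
  ∃ b : HilbertBasis ι ℝ (L2 Ω), ∀ i, b i = toL2 (u i)

/-- The family `w` is an orthonormal basis of `H₀¹(Ω)` for the gradient inner product: it lies in
`H₀¹(Ω)`, is orthonormal, and every `h ∈ H₀¹(Ω)` is the sum of its Fourier series, which
converges in the norm of `H¹(Ω)` (hence also in the weaker gradient norm). -/
structure IsGradOrthonormalBasis {ι : Type*} {Ω : Set E} (w : ι → H1 Ω) : Prop where
  mem_H10 : ∀ i, w i ∈ H10 Ω
  norm_one : ∀ i, gradInner (w i) (w i) = 1
  orthogonal : ∀ i j, i ≠ j → gradInner (w i) (w j) = 0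
  hasSum : ∀ h ∈ H10 Ω, HasSum (fun i => gradInner h (w i) • w i) h

/-- `lam`, `e` are a sequence of Dirichlet Laplacian eigenvalues on `Ω` and an associated sequence
of eigenfunctions that is an orthonormal basis of `L²(Ω)`. -/
structure IsDirichletEigenbasis (Ω : Set E) (lam : ℕ → ℝ) (e : ℕ → H1 Ω) : Prop where
  eigenfunction : ∀ j, IsDirichletEigenfunction Ω (lam j) (e j)
  basis : IsL2OrthonormalBasis e

end Sobolev

/-- `u` is the dyad `e ⊗ f`, that is `u (x, y) = e x * f y` for almost every `(x, y) ∈ Ω₁ × Ω₂`. -/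
def IsDyad {E₁ E₂ : Type*}
    [NormedAddCommGroup E₁] [InnerProductSpace ℝ E₁] [FiniteDimensional ℝ E₁]
    [MeasurableSpace E₁] [BorelSpace E₁]
    [NormedAddCommGroup E₂] [InnerProductSpace ℝ E₂] [FiniteDimensional ℝ E₂]
    [MeasurableSpace E₂] [BorelSpace E₂]
    {Ω₁ : Set E₁} {Ω₂ : Set E₂}
    (u : H1 (prodRegion Ω₁ Ω₂)) (e : H1 Ω₁) (f : H1 Ω₂) : Prop :=
  toL2 u =ᵐ[volume.restrict (prodRegion Ω₁ Ω₂)] fun z => toL2 e z.fst * toL2 f z.snd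

end

end ProductDirichlet

/-!
The proof has four ingredients.

*Dyads are eigenfunctions.* `tensor` makes `(f, g) ↦ f ⊗ g` a bounded bilinear map on `L²`, so the
dyad `e ⊗ f`, with gradient `(f ∇e, e ∇f)`, depends continuously in `H¹` on each factor. Since dyads
of test functions are test functions, the dyad of two `H₀¹` functions is in `H₀¹` of the product
(`exists_mem_H10_dyad`). To check the eigenvalue equation it suffices to test it with a test
function `Φ`; the slices `Φ (·, y)` and `Φ (x, ·)` are test functions on the factors, and Fubini's
theorem separates the variables (`inner_dyadGrad_grad`).

*Dyads are an orthonormal basis of `L²`.* Orthonormality is Fubini's theorem. A function orthogonal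
to all the dyads has almost every slice orthogonal to a basis
(`eq_zero_of_forall_inner_mulTensor_eq_zero`).

*Expansions in `H₀¹`.* For an eigenfunction `u` with eigenvalue `lam`, the `H¹` inner product with
`h ∈ H₀¹` is `1 + lam` times the `L²` inner product. Hence an `L²` orthonormal basis of
eigenfunctions is, up to scaling, an orthonormal basis of the Hilbert space `H₀¹`, and the expansion
of `h` converges in `H¹` (`hasSum_inner_toL2_smul`). Completeness in `H₀¹` is inherited from `L²`
because the weak gradient of `0` is `0` (`eq_zero_of_toL2_eq_zero`).

*Positivity and finite multiplicities.* Rescaling by `lam ^ (-1/2)` needs positive eigenvalues, and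
a *finite* linear combination needs finitely many pairs `(j, k)` with `lam₁ j + lam₂ k = lam`. Both
follow from one inequality in place of the Poincaré inequality and Rellich's theorem: the part of
`‖u‖²` at frequencies above `R` is at most `‖∇u‖² / (2πR)²`
(`norm_sq_le_integral_spectralDensity_add`), while at each frequency `ξ` Bessel's inequality bounds
`∑ |û_j(ξ)|²` by `|Ω|` for an orthonormal family `u_j`.
-/

/-- An orthonormal family in a closed subspace `K` that is complete in `K` gives convergent
expansions of all members of `K`. -/
lemma Orthonormal.hasSum_inner_smul_of_isClosed {H ι : Type*} [NormedAddCommGroup H]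
    [InnerProductSpace ℝ H] [CompleteSpace H] {w : ι → H} (ho : Orthonormal ℝ w)
    {K : Submodule ℝ H} (hK : IsClosed (K : Set H)) (hw : ∀ i, w i ∈ K)
    (hz : ∀ v ∈ K, (∀ i, ⟪w i, v⟫ = 0) → v = 0) {h : H} (hh : h ∈ K) :
    HasSum (fun i => ⟪w i, h⟫ • w i) h := by
  have : CompleteSpace K := hK.completeSpace_coe
  have ho' : Orthonormal ℝ fun i => (⟨w i, hw i⟩ : K) :=
    ho.codRestrict K hw
  have hbot : (Submodule.span ℝ (Set.range fun i => (⟨w i, hw i⟩ : K)))ᗮ = ⊥ := by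
    rw [Submodule.eq_bot_iff]
    intro v hv
    refine Subtype.ext (hz v v.2 fun i => ?_)
    exact (Submodule.mem_orthogonal _ _).mp hv ⟨w i, hw i⟩ (Submodule.subset_span ⟨i, rfl⟩)
  have hsum := ((HilbertBasis.mkOfOrthogonalEqBot ho' hbot).hasSum_repr ⟨h, hh⟩).mapL K.subtypeL
  simp_rw [HilbertBasis.repr_apply_apply, HilbertBasis.coe_mkOfOrthogonalEqBot] at hsum
  exact hsum

namespace ProductDirichlet

noncomputable section

set_option linter.unusedSectionVars false

/-! ### The Sobolev spaces `H¹` and `H₀¹` -/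

section Sobolev

variable {E : Type*} [NormedAddCommGroup E] [InnerProductSpace ℝ E] [FiniteDimensional ℝ E]
  [MeasurableSpace E] [BorelSpace E] {Ω : Set E}

namespace IsTestFunction

variable {φ ψ : E → ℝ}

lemma gradient_eq_zero (h : IsTestFunction Ω φ) {x : E} (hx : x ∉ Ω) : gradient φ x = 0 := by
  have : fderiv ℝ φ x = 0 := by
    by_contra hne
    exact hx (h.tsupport_subset (support_fderiv_subset ℝ hne))
  simp [gradient, this]

lemma eq_zero (h : IsTestFunction Ω φ) {x : E} (hx : x ∉ Ω) : φ x = 0 :=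
  image_eq_zero_of_notMem_tsupport fun h' => hx (h.tsupport_subset h')

lemma memLp (h : IsTestFunction Ω φ) : MemLp φ 2 (volume.restrict Ω) :=
  (h.contDiff.continuous.memLp_of_hasCompactSupport h.hasCompactSupport).restrict Ω

lemma memLp_gradient (h : IsTestFunction Ω φ) : MemLp (gradient φ) 2 (volume.restrict Ω) :=
  (h.continuous_gradient.memLp_of_hasCompactSupport h.hasCompactSupport_gradient).restrict Ω

/-- Integration by parts: the classical gradient of a test function is its weak gradient. -/
lemma setIntegral_smul_gradient (hφ : IsTestFunction Ω φ) (hψ : IsTestFunction Ω ψ) :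
    ∫ x in Ω, φ x • gradient ψ x = - ∫ x in Ω, ψ x • gradient φ x := by
  rw [setIntegral_eq_integral_of_forall_compl_eq_zero fun x hx => by simp [hφ.eq_zero hx],
    setIntegral_eq_integral_of_forall_compl_eq_zero fun x hx => by simp [hψ.eq_zero hx]]
  have hi : ∀ {f g : E → ℝ}, IsTestFunction Ω f → IsTestFunction Ω g →
      Integrable (fun x => f x • gradient g x) := fun {f g} hf hg =>
    (hf.contDiff.continuous.smul hg.continuous_gradient).integrable_of_hasCompactSupport
      hf.hasCompactSupport.smul_right
  refine ext_inner_left ℝ fun c => ?_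
  rw [inner_neg_right, ← integral_inner (hi hφ hψ), ← integral_inner (hi hψ hφ)]
  have e : ∀ (f g : E → ℝ) (x : E), ⟪c, f x • gradient g x⟫ = f x * fderiv ℝ g x c := by
    intro f g x
    rw [real_inner_smul_right, real_inner_comm, inner_gradient_left]
  simp_rw [e]
  have hi' : ∀ {f g : E → ℝ}, IsTestFunction Ω f → IsTestFunction Ω g →
      Integrable (fun x => f x * fderiv ℝ g x c) := fun {f g} hf hg => by
    simpa only [e] using (hi hf hg).const_inner (𝕜 := ℝ) c
  rw [integral_mul_fderiv_eq_neg_fderiv_mul_of_integrable]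
  · simp_rw [mul_comm]
  · simpa only [mul_comm] using hi' hψ hφ
  · exact hi' hφ hψ
  · exact (hφ.contDiff.continuous.mul hψ.contDiff.continuous).integrable_of_hasCompactSupport
      hφ.hasCompactSupport.mul_right
  · exact fun x _ => (hφ.contDiff.differentiable (by simp)).differentiableAt
  · exact fun x _ => (hψ.contDiff.differentiable (by simp)).differentiableAt

end IsTestFunction

/-- `u` is the class in `H¹(Ω)` of the test function `φ`. -/
def IsTestClass (u : H1 Ω) (φ : E → ℝ) : Prop :=
  IsTestFunction Ω φ ∧ toL2 u =ᵐ[volume.restrict Ω] φ ∧ grad u =ᵐ[volume.restrict Ω] gradient φ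

lemma IsTestFunction.exists_isTestClass {φ : E → ℝ} (h : IsTestFunction Ω φ) :
    ∃ u : H1 Ω, IsTestClass u φ := by
  refine ⟨⟨WithLp.toLp 2 (h.memLp.toLp φ, h.memLp_gradient.toLp _), ?_⟩, h,
    h.memLp.coeFn_toLp, h.memLp_gradient.coeFn_toLp⟩
  intro ψ hψ
  refine Eq.trans (integral_congr_ae ?_) ((h.setIntegral_smul_gradient hψ).trans
    (congrArg Neg.neg (integral_congr_ae ?_)))
  · filter_upwards [h.memLp.coeFn_toLp] with x hx
    exact congrArg (· • gradient ψ x) hx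
  · filter_upwards [h.memLp_gradient.coeFn_toLp] with x hx
    exact congrArg (ψ x • ·) hx.symm

/-- The map `u ↦ u` from `H¹(Ω)` to `L²(Ω)`, as a continuous linear map. -/
def toL2L (Ω : Set E) : H1 Ω →L[ℝ] L2 Ω :=
  (WithLp.fstL 2 ℝ (L2 Ω) (L2Vec Ω)).comp (H1 Ω).subtypeL

/-- The map `u ↦ ∇u` from `H¹(Ω)` to `L²(Ω; E)`, as a continuous linear map. -/
def gradL (Ω : Set E) : H1 Ω →L[ℝ] L2Vec Ω :=
  (WithLp.sndL 2 ℝ (L2 Ω) (L2Vec Ω)).comp (H1 Ω).subtypeL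

lemma gradInner_eq_inner (u v : H1 Ω) : gradInner u v = ⟪grad u, grad v⟫ :=
  (L2.inner_def _ _).symm

lemma inner_eq_add_gradInner (u v : H1 Ω) : ⟪u, v⟫ = ⟪toL2 u, toL2 v⟫ + gradInner u v := by
  rw [gradInner_eq_inner]
  exact WithLp.prod_inner_apply _ _

lemma integral_mul_eq_inner (f g : L2 Ω) : ∫ x in Ω, f x * g x = ⟪f, g⟫ := by
  rw [L2.inner_def]
  exact integral_congr_ae (.of_forall fun x => by simp [mul_comm])

lemma mem_H10_of_isTestClass {u : H1 Ω} {φ : E → ℝ} (h : IsTestClass u φ) : u ∈ H10 Ω :=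
  Submodule.le_topologicalClosure _ (Submodule.subset_span ⟨φ, h⟩)

/-- The classes of test functions are dense in `H₀¹(Ω)`. They form a linear subspace, so the linear
span in the definition of `H10` adds nothing. -/
lemma H10_induction {s : Set (H1 Ω)} (hs : IsClosed s)
    (h : ∀ u φ, IsTestClass u φ → u ∈ s) {u : H1 Ω} (hu : u ∈ H10 Ω) : u ∈ s := by
  refine closure_minimal (s := ((Submodule.span ℝ {u : H1 Ω | ∃ φ : E → ℝ, IsTestClass u φ} :
    Submodule ℝ (H1 Ω)) : Set (H1 Ω))) ?_ hs hu
  intro v hv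
  suffices ∃ φ, IsTestClass v φ from h v _ this.choose_spec
  induction hv using Submodule.span_induction with
  | mem x hx => exact hx
  | zero =>
    have h0 : IsTestFunction Ω (fun _ => 0) :=
      ⟨contDiff_const, HasCompactSupport.zero, by simp [tsupport]⟩
    refine ⟨fun _ => 0, h0, Lp.coeFn_zero ℝ 2 (volume.restrict Ω), ?_⟩
    filter_upwards [Lp.coeFn_zero E 2 (volume.restrict Ω)] with x hx
    rw [gradient_fun_const]
    exact hx
  | add x y _ _ hx hy =>
    obtain ⟨φ, hφ, h1, h2⟩ := hx
    obtain ⟨ψ, hψ, h3, h4⟩ := hy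
    refine ⟨φ + ψ, ⟨hφ.contDiff.add hψ.contDiff, hφ.hasCompactSupport.add hψ.hasCompactSupport,
      (tsupport_add φ ψ).trans (Set.union_subset hφ.tsupport_subset hψ.tsupport_subset)⟩, ?_, ?_⟩
    · exact (Lp.coeFn_add (toL2 x) (toL2 y)).trans (h1.add h3)
    · refine (Lp.coeFn_add (grad x) (grad y)).trans ((h2.add h4).trans (.of_forall fun z => ?_))
      simp only [gradient, Pi.add_apply]
      rw [fderiv_add (hφ.contDiff.differentiable (by simp)).differentiableAt
        (hψ.contDiff.differentiable (by simp)).differentiableAt, map_add]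
  | smul c x _ hx =>
    obtain ⟨φ, hφ, h1, h2⟩ := hx
    refine ⟨c • φ, ⟨hφ.contDiff.const_smul c, hφ.hasCompactSupport.smul_left (f := fun _ => c),
      (tsupport_smul_subset_right (fun _ => c) φ).trans hφ.tsupport_subset⟩, ?_, ?_⟩
    · exact (Lp.coeFn_smul c (toL2 x)).trans (h1.const_smul c)
    · refine (Lp.coeFn_smul c (grad x)).trans ((h2.const_smul c).trans (.of_forall fun z => ?_))
      simp only [gradient, Pi.smul_apply]
      rw [fderiv_const_smul (hφ.contDiff.differentiable (by simp)).differentiableAt, map_smul]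

/-- The weak gradient identity, tested against a vector `c`, as a pair of `L²` inner products. -/
lemma isWeakGradient_iff_inner {u : L2 Ω} {g : L2Vec Ω} :
    IsWeakGradient Ω u g ↔ ∀ (φ : E → ℝ) (hφ : IsTestFunction Ω φ) (c : E),
      ⟪(hφ.memLp_gradient.const_inner c).toLp (fun x => ⟪c, gradient φ x⟫), u⟫
        + ⟪((ContinuousLinearMap.toSpanSingleton ℝ c).comp_memLp' hφ.memLp).toLp
          ((ContinuousLinearMap.toSpanSingleton ℝ c) ∘ φ), g⟫ = 0 := by
  refine forall_congr' fun φ => forall_congr' fun hφ => ?_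
  have h1 : ∀ c : E, ⟪(hφ.memLp_gradient.const_inner c).toLp (fun x => ⟪c, gradient φ x⟫), u⟫
      = ⟪c, ∫ x in Ω, u x • gradient φ x⟫ := by
    intro c
    rw [← integral_inner (hφ.integrable_left u), L2.inner_def]
    refine integral_congr_ae ?_
    filter_upwards [(hφ.memLp_gradient.const_inner (𝕜 := ℝ) c).coeFn_toLp] with x hx
    rw [hx, real_inner_smul_right]
    simp
  have h2 : ∀ c : E, ⟪((ContinuousLinearMap.toSpanSingleton ℝ c).comp_memLp' hφ.memLp).toLp
          ((ContinuousLinearMap.toSpanSingleton ℝ c) ∘ φ), g⟫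
      = ⟪c, ∫ x in Ω, φ x • g x⟫ := by
    intro c
    rw [← integral_inner (hφ.integrable_right g), L2.inner_def]
    refine integral_congr_ae ?_
    filter_upwards [((ContinuousLinearMap.toSpanSingleton ℝ c).comp_memLp' hφ.memLp).coeFn_toLp]
      with x hx
    rw [hx, real_inner_smul_right]
    simp [real_inner_smul_left]
  simp_rw [h1, h2, ← inner_add_right]
  rw [eq_neg_iff_add_eq_zero]
  exact ⟨fun h c => by rw [h, inner_zero_right], fun h => ext_inner_left ℝ fun c => by
    rw [h, inner_zero_right]⟩

lemma isClosed_H1 (Ω : Set E) : IsClosed (H1 Ω : Set (WithLp 2 (L2 Ω × L2Vec Ω))) := by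
  have : (H1 Ω : Set (WithLp 2 (L2 Ω × L2Vec Ω))) = {p | IsWeakGradient Ω p.fst p.snd} := rfl
  rw [this]
  simp_rw [isWeakGradient_iff_inner, Set.ofPred_forall]
  refine isClosed_iInter fun φ => isClosed_iInter fun hφ => isClosed_iInter fun c =>
    isClosed_eq ?_ continuous_const
  exact (Continuous.inner continuous_const (WithLp.fstL 2 ℝ (L2 Ω) (L2Vec Ω)).continuous).add
    (Continuous.inner continuous_const (WithLp.sndL 2 ℝ (L2 Ω) (L2Vec Ω)).continuous)

instance : CompleteSpace (H1 Ω) := (isClosed_H1 Ω).completeSpace_coe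

lemma isClosed_H10 (Ω : Set E) : IsClosed (H10 Ω : Set (H1 Ω)) :=
  Submodule.isClosed_topologicalClosure _

/-- Uniqueness of the weak gradient: an `H¹` function that vanishes has vanishing gradient. -/
lemma eq_zero_of_toL2_eq_zero (hΩ : IsOpen Ω) {u : H1 Ω} (hu : toL2 u = 0) : u = 0 := by
  have hg : ∀ᵐ x, x ∈ Ω → grad u x = 0 := by
    refine hΩ.ae_eq_zero_of_integral_contDiff_smul_eq_zero ?_ ?_
    · refine fun x hx => ⟨Ω ∩ Metric.ball x 1, Filter.inter_mem self_mem_nhdsWithin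
        (mem_nhdsWithin_of_mem_nhds (Metric.ball_mem_nhds x one_pos)), ?_⟩
      have : IsFiniteMeasure ((volume.restrict Ω).restrict (Metric.ball x 1)) :=
        ⟨by
          rw [Measure.restrict_apply_univ]
          exact (Measure.restrict_apply_le _ _).trans_lt Metric.isBounded_ball.measure_lt_top⟩
      have h := ((Lp.memLp (grad u)).restrict (Metric.ball x 1)).integrable one_le_two
      rwa [Measure.restrict_restrict measurableSet_ball, Set.inter_comm] at h
    · intro φ h1 h2 h3
      have hφ : IsTestFunction Ω φ := ⟨h1, h2, h3⟩
      have := u.2 φ hφ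
      rw [← setIntegral_eq_integral_of_forall_compl_eq_zero (s := Ω)
        fun x hx => by simp [hφ.eq_zero hx]]
      have h0 : ∫ x in Ω, toL2 u x • gradient φ x = 0 := by
        refine integral_eq_zero_of_ae ?_
        rw [hu]
        filter_upwards [Lp.coeFn_zero ℝ 2 (volume.restrict Ω)] with x hx
        rw [hx, Pi.zero_apply, zero_smul, Pi.zero_apply]
      exact neg_eq_zero.mp (this.symm.trans h0)
  have hg' : grad u = 0 := by
    refine Lp.ext ?_
    filter_upwards [(ae_restrict_iff' hΩ.measurableSet).mpr hg,
      Lp.coeFn_zero E 2 (volume.restrict Ω)] with x hx h0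
    rw [hx, h0, Pi.zero_apply]
  exact Subtype.ext (WithLp.ofLp_injective 2 (Prod.ext hu hg'))

end Sobolev

/-! ### A low-frequency bound, finite multiplicities, and the Poincaré inequality -/

section LowFrequency

variable {E : Type*} [NormedAddCommGroup E] [InnerProductSpace ℝ E] [FiniteDimensional ℝ E]
  [MeasurableSpace E] [BorelSpace E] {Ω : Set E}

open Real FourierTransform

lemma memLp_cos_inner (Ω : Set E) [IsFiniteMeasure (volume.restrict Ω)] (ξ : E) :
    MemLp (fun x => cos (2 * π * ⟪x, ξ⟫)) 2 (volume.restrict Ω) :=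
  MemLp.of_bound (by fun_prop) 1 (.of_forall fun x => abs_cos_le_one _)

lemma memLp_sin_inner (Ω : Set E) [IsFiniteMeasure (volume.restrict Ω)] (ξ : E) :
    MemLp (fun x => sin (2 * π * ⟪x, ξ⟫)) 2 (volume.restrict Ω) :=
  MemLp.of_bound (by fun_prop) 1 (.of_forall fun x => abs_sin_le_one _)

/-- The class in `L²(Ω)` of `x ↦ cos (2π ⟪x, ξ⟫)`, the real part of a plane wave. -/
def cosMode (Ω : Set E) [IsFiniteMeasure (volume.restrict Ω)] (ξ : E) : L2 Ω :=
  (memLp_cos_inner Ω ξ).toLp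

/-- The class in `L²(Ω)` of `x ↦ sin (2π ⟪x, ξ⟫)`, the imaginary part of a plane wave. -/
def sinMode (Ω : Set E) [IsFiniteMeasure (volume.restrict Ω)] (ξ : E) : L2 Ω :=
  (memLp_sin_inner Ω ξ).toLp

/-- The squared modulus at frequency `ξ` of the Fourier transform of `u` (extended by zero). -/
def spectralDensity [IsFiniteMeasure (volume.restrict Ω)] (u : L2 Ω) (ξ : E) : ℝ :=
  ⟪cosMode Ω ξ, u⟫ ^ 2 + ⟪sinMode Ω ξ, u⟫ ^ 2

variable [IsFiniteMeasure (volume.restrict Ω)]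

lemma inner_cosMode (ξ : E) (u : L2 Ω) :
    ⟪cosMode Ω ξ, u⟫ = ∫ x in Ω, cos (2 * π * ⟪x, ξ⟫) * u x := by
  rw [← integral_mul_eq_inner]
  refine integral_congr_ae ?_
  filter_upwards [(memLp_cos_inner Ω ξ).coeFn_toLp] with x hx
  exact congrArg (· * u x) hx

lemma inner_sinMode (ξ : E) (u : L2 Ω) :
    ⟪sinMode Ω ξ, u⟫ = ∫ x in Ω, sin (2 * π * ⟪x, ξ⟫) * u x := by
  rw [← integral_mul_eq_inner]
  refine integral_congr_ae ?_
  filter_upwards [(memLp_sin_inner Ω ξ).coeFn_toLp] with x hx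
  exact congrArg (· * u x) hx

lemma norm_cosMode_sq_add_norm_sinMode_sq (ξ : E) :
    ‖cosMode Ω ξ‖ ^ 2 + ‖sinMode Ω ξ‖ ^ 2 = volume.real Ω := by
  rw [← real_inner_self_eq_norm_sq, ← real_inner_self_eq_norm_sq, inner_cosMode, inner_sinMode]
  have h1 : ∫ x in Ω, cos (2 * π * ⟪x, ξ⟫) * cosMode Ω ξ x
      = ∫ x in Ω, cos (2 * π * ⟪x, ξ⟫) ^ 2 := by
    refine integral_congr_ae ?_
    filter_upwards [(memLp_cos_inner Ω ξ).coeFn_toLp] with x hx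
    rw [cosMode, hx, sq]
  have h2 : ∫ x in Ω, sin (2 * π * ⟪x, ξ⟫) * sinMode Ω ξ x
      = ∫ x in Ω, sin (2 * π * ⟪x, ξ⟫) ^ 2 := by
    refine integral_congr_ae ?_
    filter_upwards [(memLp_sin_inner Ω ξ).coeFn_toLp] with x hx
    rw [sinMode, hx, sq]
  rw [h1, h2, ← integral_add (memLp_cos_inner Ω ξ).integrable_sq
    (memLp_sin_inner Ω ξ).integrable_sq]
  simp

/-- Bessel's inequality for a plane wave. -/
lemma sum_spectralDensity_le {ι : Type*} {v : ι → L2 Ω} (hv : Orthonormal ℝ v) (s : Finset ι)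
    (ξ : E) : ∑ i ∈ s, spectralDensity (v i) ξ ≤ volume.real Ω := by
  rw [← norm_cosMode_sq_add_norm_sinMode_sq ξ]
  simp only [spectralDensity, Finset.sum_add_distrib]
  have h := hv.sum_inner_products_le (cosMode Ω ξ) (s := s)
  have h' := hv.sum_inner_products_le (sinMode Ω ξ) (s := s)
  simp only [norm_eq_abs, sq_abs] at h h'
  simp only [real_inner_comm _ (cosMode Ω ξ), real_inner_comm _ (sinMode Ω ξ)] at *
  exact add_le_add h h'

lemma spectralDensity_nonneg (u : L2 Ω) (ξ : E) : 0 ≤ spectralDensity u ξ := by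
  unfold spectralDensity; positivity

lemma spectralDensity_le (u : L2 Ω) (ξ : E) :
    spectralDensity u ξ ≤ volume.real Ω * ‖u‖ ^ 2 := by
  rw [← norm_cosMode_sq_add_norm_sinMode_sq ξ, add_mul, ← mul_pow, ← mul_pow]
  have h1 := abs_real_inner_le_norm (cosMode Ω ξ) u
  have h2 := abs_real_inner_le_norm (sinMode Ω ξ) u
  exact add_le_add (sq_le_sq' (abs_le.mp h1).1 (abs_le.mp h1).2)
    (sq_le_sq' (abs_le.mp h2).1 (abs_le.mp h2).2)

lemma continuous_spectralDensity (u : L2 Ω) : Continuous (spectralDensity u) := by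
  have hu : Integrable (fun x => ‖u x‖) (volume.restrict Ω) :=
    ((Lp.memLp u).integrable one_le_two).norm
  have hm : AEStronglyMeasurable u (volume.restrict Ω) := Lp.aestronglyMeasurable u
  have h1 : Continuous fun ξ => ⟪cosMode Ω ξ, u⟫ := by
    simp_rw [inner_cosMode]
    refine continuous_of_dominated (fun ξ => ?_) (fun ξ => .of_forall fun x => ?_) hu
      (.of_forall fun x => by fun_prop)
    · exact AEStronglyMeasurable.mul (by fun_prop) hm
    · rw [norm_mul]
      exact mul_le_of_le_one_left (norm_nonneg _) (abs_cos_le_one _)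
  have h2 : Continuous fun ξ => ⟪sinMode Ω ξ, u⟫ := by
    simp_rw [inner_sinMode]
    refine continuous_of_dominated (fun ξ => ?_) (fun ξ => .of_forall fun x => ?_) hu
      (.of_forall fun x => by fun_prop)
    · exact AEStronglyMeasurable.mul (by fun_prop) hm
    · rw [norm_mul]
      exact mul_le_of_le_one_left (norm_nonneg _) (abs_sin_le_one _)
  exact (h1.pow 2).add (h2.pow 2)

lemma integrableOn_spectralDensity (u : L2 Ω) (R : ℝ) :
    IntegrableOn (spectralDensity u) (Metric.ball 0 R) :=
  ((continuous_spectralDensity u).continuousOn.integrableOn_compact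
    (isCompact_closedBall (0 : E) R)).mono_set Metric.ball_subset_closedBall

lemma continuous_integral_spectralDensity (R : ℝ) :
    Continuous fun u : L2 Ω => ∫ ξ in Metric.ball (0 : E) R, spectralDensity u ξ := by
  refine continuous_iff_continuousAt.mpr fun u₀ => ?_
  refine continuousAt_of_dominated (bound := fun _ => volume.real Ω * (‖u₀‖ + 1) ^ 2)
    (.of_forall fun u => (continuous_spectralDensity u).aestronglyMeasurable) ?_
    (integrableOn_const Metric.isBounded_ball.measure_lt_top.ne) (.of_forall fun ξ => ?_)
  · filter_upwards [Metric.ball_mem_nhds u₀ one_pos] with u hu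
    refine .of_forall fun ξ => ?_
    rw [norm_of_nonneg (spectralDensity_nonneg u ξ)]
    refine (spectralDensity_le u ξ).trans ?_
    have : ‖u‖ ≤ ‖u₀‖ + 1 := by
      have h1 := norm_sub_norm_le u u₀
      rw [mem_ball_iff_norm] at hu
      linarith
    gcongr
  · unfold spectralDensity
    fun_prop

omit [IsFiniteMeasure (volume.restrict Ω)] in
/-- Plancherel for the gradient of a test function, through its coordinates in an orthonormal basis.
The Schwartz function `f` is the test function `φ` with values regarded as complex numbers. -/
lemma IsTestFunction.integral_norm_gradient_sq {φ : E → ℝ} (h : IsTestFunction Ω φ) :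
    ∃ f : SchwartzMap E ℂ, (∀ x, f x = φ x) ∧
      Integrable (fun ξ => (2 * π * ‖ξ‖) ^ 2 * ‖𝓕 f ξ‖ ^ 2) ∧
      ∫ ξ, (2 * π * ‖ξ‖) ^ 2 * ‖𝓕 f ξ‖ ^ 2 = ∫ x, ‖gradient φ x‖ ^ 2 := by
  have hc : HasCompactSupport fun x => (φ x : ℂ) :=
    h.hasCompactSupport.comp_left (g := ((↑) : ℝ → ℂ)) Complex.ofReal_zero
  have hd : ContDiff ℝ ∞ fun x => (φ x : ℂ) := Complex.ofRealCLM.contDiff.comp h.contDiff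
  let f : SchwartzMap E ℂ := hc.toSchwartzMap hd
  have hf : ∀ x, f x = φ x := fun x => rfl
  let b := stdOrthonormalBasis ℝ E
  have hF : ∀ m ξ, ‖(𝓕 (LineDeriv.lineDerivOp m f) : SchwartzMap E ℂ) ξ‖ ^ 2
      = (2 * π) ^ 2 * ⟪ξ, m⟫ ^ 2 * ‖𝓕 f ξ‖ ^ 2 := by
    intro m ξ
    rw [SchwartzMap.fourier_lineDerivOp_eq, smul_apply,
      SchwartzMap.smulLeftCLM_apply_apply (by fun_prop)]
    simp only [smul_eq_mul, norm_mul, norm_smul, mul_pow, Complex.norm_I, mul_one,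
      Complex.norm_ofNat, Complex.norm_real, norm_eq_abs, sq_abs]
    ring
  have hD : ∀ m x, (LineDeriv.lineDerivOp m f : SchwartzMap E ℂ) x = (fderiv ℝ φ x m : ℂ) := by
    intro m x
    rw [SchwartzMap.lineDerivOp_apply_eq_fderiv]
    have : HasFDerivAt f (Complex.ofRealCLM.comp (fderiv ℝ φ x)) x :=
      Complex.ofRealCLM.hasFDerivAt.comp x
        (h.contDiff.differentiable (by simp)).differentiableAt.hasFDerivAt
    rw [this.fderiv]
    rfl
  have hsum : ∀ v : E, ‖v‖ ^ 2 = ∑ i, ⟪v, b i⟫ ^ 2 := fun v => by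
    rw [← b.sum_sq_norm_inner_left v]
    simp
  have hint : ∀ i, Integrable (fun ξ =>
      ‖(𝓕 (LineDeriv.lineDerivOp (b i) f) : SchwartzMap E ℂ) ξ‖ ^ 2) := fun i =>
    (memLp_two_iff_integrable_sq_norm (SchwartzMap.continuous _).aestronglyMeasurable).mp
      (SchwartzMap.memLp _ 2 _)
  have hint' : ∀ i, Integrable (fun x =>
      ‖(LineDeriv.lineDerivOp (b i) f : SchwartzMap E ℂ) x‖ ^ 2) := fun i =>
    (memLp_two_iff_integrable_sq_norm (SchwartzMap.continuous _).aestronglyMeasurable).mp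
      (SchwartzMap.memLp _ 2 _)
  have e1 : (fun ξ => (2 * π * ‖ξ‖) ^ 2 * ‖𝓕 f ξ‖ ^ 2)
      = fun ξ => ∑ i, ‖(𝓕 (LineDeriv.lineDerivOp (b i) f) : SchwartzMap E ℂ) ξ‖ ^ 2 := by
    ext ξ
    simp_rw [hF, ← Finset.sum_mul, ← Finset.mul_sum, ← hsum, mul_pow]
  have e2 : (fun x => ‖gradient φ x‖ ^ 2)
      = fun x => ∑ i, ‖(LineDeriv.lineDerivOp (b i) f : SchwartzMap E ℂ) x‖ ^ 2 := by
    ext x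
    rw [hsum]
    refine Finset.sum_congr rfl fun i _ => ?_
    rw [hD, inner_gradient_left, Complex.norm_real, norm_eq_abs, sq_abs]
  refine ⟨f, hf, ?_, ?_⟩
  · rw [e1]
    exact integrable_finsetSum _ fun i _ => hint i
  · rw [e1, e2, integral_finsetSum _ fun i _ => hint i, integral_finsetSum _ fun i _ => hint' i]
    exact Finset.sum_congr rfl fun i _ => SchwartzMap.integral_norm_sq_fourier _

lemma IsTestClass.norm_fourier_sq {u : H1 Ω} {φ : E → ℝ} (h : IsTestClass u φ)
    {f : SchwartzMap E ℂ} (hf : ∀ x, f x = φ x) (ξ : E) :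
    ‖𝓕 f ξ‖ ^ 2 = spectralDensity (toL2 u) ξ := by
  have hi : Integrable (fun v => Complex.exp (↑(-2 * π * ⟪v, ξ⟫) * Complex.I) • f v) := by
    have hm : Continuous fun v : E => Complex.exp (↑(-2 * π * ⟪v, ξ⟫) * Complex.I) := by fun_prop
    refine f.integrable.bdd_smul 1 hm.aestronglyMeasurable (.of_forall fun v => ?_)
    rw [Complex.norm_exp_ofReal_mul_I]
  have hset : ∀ g : ℝ → ℝ, ∫ x in Ω, g (2 * π * ⟪x, ξ⟫) * toL2 u x
      = ∫ x, g (2 * π * ⟪x, ξ⟫) * φ x := by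
    intro g
    refine Eq.trans (integral_congr_ae ?_) (setIntegral_eq_integral_of_forall_compl_eq_zero
      fun x hx => by rw [h.1.eq_zero hx, mul_zero])
    filter_upwards [h.2.1] with x hx
    rw [hx]
  rw [spectralDensity, inner_cosMode, inner_sinMode, hset, hset, SchwartzMap.fourier_coe,
    Real.fourier_eq']
  have hre := Complex.reCLM.integral_comp_comm hi
  have him := Complex.imCLM.integral_comp_comm hi
  rw [← Complex.normSq_eq_norm_sq, Complex.normSq_apply, ← sq, ← sq]
  congr 1
  · refine congrArg (· ^ 2) (hre.symm.trans (integral_congr_ae (.of_forall fun x => ?_)))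
    simp [hf, Complex.exp_ofReal_mul_I_re, -Complex.ofReal_mul, -Complex.ofReal_neg, neg_mul]
  · rw [← neg_sq]
    refine congrArg (· ^ 2) ?_
    refine (congrArg Neg.neg him.symm).trans ?_
    rw [← integral_neg]
    refine integral_congr_ae (.of_forall fun x => ?_)
    simp [hf, Complex.exp_ofReal_mul_I_im, -Complex.ofReal_mul, -Complex.ofReal_neg, neg_mul]

/-- Splitting the frequency space at `‖ξ‖ = R`: below it one keeps the spectral density, above it
one uses that `(2π‖ξ‖)²` times the density has integral `‖∇u‖²`. -/
theorem norm_sq_le_integral_spectralDensity_add {u : H1 Ω} (hu : u ∈ H10 Ω) {R : ℝ} (hR : 0 < R) :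
    ‖toL2 u‖ ^ 2 ≤ (∫ ξ in Metric.ball (0 : E) R, spectralDensity (toL2 u) ξ)
      + ‖grad u‖ ^ 2 / (2 * π * R) ^ 2 := by
  refine H10_induction (s := {u | ‖toL2 u‖ ^ 2 ≤
    (∫ ξ in Metric.ball (0 : E) R, spectralDensity (toL2 u) ξ)
      + ‖grad u‖ ^ 2 / (2 * π * R) ^ 2}) ?_ ?_ hu
  · refine isClosed_le ((toL2L Ω).continuous.norm.pow 2) (Continuous.add ?_ ?_)
    · exact (continuous_integral_spectralDensity R).comp (toL2L Ω).continuous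
    · exact ((gradL Ω).continuous.norm.pow 2).div_const _
  · intro u φ h
    obtain ⟨f, hf, hi, hg⟩ := h.1.integral_norm_gradient_sq
    have hfi : Integrable (fun ξ => ‖𝓕 f ξ‖ ^ 2) :=
      (memLp_two_iff_integrable_sq_norm (SchwartzMap.continuous _).aestronglyMeasurable).mp
        (SchwartzMap.memLp _ 2 _)
    have hn : ‖toL2 u‖ ^ 2 = ∫ ξ, ‖𝓕 f ξ‖ ^ 2 := by
      rw [SchwartzMap.integral_norm_sq_fourier, ← real_inner_self_eq_norm_sq, L2.inner_def]
      refine Eq.trans (integral_congr_ae ?_) (setIntegral_eq_integral_of_forall_compl_eq_zero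
        fun x hx => by simp [hf, h.1.eq_zero hx])
      filter_upwards [h.2.1] with x hx
      rw [hx, hf, Complex.norm_real, real_inner_self_eq_norm_sq]
    have hgn : ‖grad u‖ ^ 2 = ∫ x, ‖gradient φ x‖ ^ 2 := by
      rw [← real_inner_self_eq_norm_sq, L2.inner_def]
      refine Eq.trans (integral_congr_ae ?_) (setIntegral_eq_integral_of_forall_compl_eq_zero
        fun x hx => by simp [h.1.gradient_eq_zero hx])
      filter_upwards [h.2.2] with x hx
      rw [hx, real_inner_self_eq_norm_sq]
    have hpos : 0 < (2 * π * R) ^ 2 := by positivity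
    change ‖toL2 u‖ ^ 2 ≤ _
    rw [hgn, ← hg, hn, ← integral_add_compl (measurableSet_ball (x := (0 : E)) (ε := R)) hfi,
      ← integral_div]
    refine add_le_add (le_of_eq ?_) ?_
    · exact integral_congr_ae (.of_forall fun ξ => h.norm_fourier_sq hf ξ)
    · refine (setIntegral_mono_on hfi.integrableOn (hi.div_const _).integrableOn
        measurableSet_ball.compl fun ξ hξ => ?_).trans
        (setIntegral_le_integral (hi.div_const _) (.of_forall fun ξ => ?_))
      · rw [le_div_iff₀ hpos, mul_comm]
        have : R ≤ ‖ξ‖ := by simpa using hξ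
        gcongr
      · positivity

/-- Finite multiplicity: an orthonormal family in `H₀¹(Ω)` with bounded gradients is finite. At a
high enough cut-off `R`, each member has at least half of its mass in the ball of frequencies of
radius `R`, where by Bessel's inequality the total mass is at most `|Ω| |B_R|`. -/
theorem finite_of_orthonormal_of_norm_grad_sq_le {ι : Type*} {v : ι → H1 Ω}
    (hv : ∀ i, v i ∈ H10 Ω) (ho : Orthonormal ℝ fun i => toL2 (v i)) {C : ℝ}
    (hC : ∀ i, ‖grad (v i)‖ ^ 2 ≤ C) : Finite ι := by
  -- With this cut-off `C ≤ R ≤ (2πR)² / 2`, so the mass above `R` is at most `1 / 2`.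
  set R : ℝ := |C| + 1
  have hR : 0 < R := by positivity
  set M : ℝ := volume.real Ω * volume.real (Metric.ball (0 : E) R)
  have key : ∀ s : Finset ι, (s.card : ℝ) ≤ 2 * M := by
    intro s
    have h1 : ∀ i ∈ s, (1 / 2 : ℝ) ≤
        ∫ ξ in Metric.ball (0 : E) R, spectralDensity (toL2 (v i)) ξ := by
      intro i _
      have h := norm_sq_le_integral_spectralDensity_add (hv i) hR
      rw [ho.1 i] at h
      have h2 : ‖grad (v i)‖ ^ 2 / (2 * π * R) ^ 2 ≤ 1 / 2 := by
        rw [div_le_iff₀ (by positivity)]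
        have hπ : 3 < π := pi_gt_three
        have hR1 : 1 ≤ R := by simp [R]
        have hCR : C ≤ R := by simp only [R]; linarith [le_abs_self C]
        have h3 : R ≤ (2 * π * R) ^ 2 / 2 := by
          have : 6 * R ≤ 2 * π * R := by gcongr; linarith
          nlinarith
        linarith [hC i]
      linarith
    have h2 : ∑ i ∈ s, ∫ ξ in Metric.ball (0 : E) R, spectralDensity (toL2 (v i)) ξ ≤ M := by
      rw [← integral_finsetSum _ fun i _ => integrableOn_spectralDensity _ R]
      refine (integral_mono (integrable_finsetSum _ fun i _ => integrableOn_spectralDensity _ R)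
        (integrableOn_const Metric.isBounded_ball.measure_lt_top.ne)
        fun ξ => sum_spectralDensity_le ho s ξ).trans (le_of_eq ?_)
      simp [M, mul_comm]
    have h3 := Finset.sum_le_sum h1
    simp only [Finset.sum_const, nsmul_eq_mul] at h3
    linarith
  by_contra hinf
  rw [not_finite_iff_infinite] at hinf
  obtain ⟨n, hn⟩ := exists_nat_gt (2 * M)
  obtain ⟨s, hs⟩ := Infinite.exists_subset_card_eq ι n
  have := key s
  rw [hs] at this
  linarith

/-- Poincaré's inequality in qualitative form: a function in `H₀¹(Ω)` with zero gradient vanishes.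
Such a function has all its mass at frequencies below `R`, for every `R > 0`; and the mass there is
at most `|Ω| |B_R| ‖u‖²`, which is small for small `R` in positive dimension. -/
theorem toL2_eq_zero_of_grad_eq_zero [Nontrivial E] {u : H1 Ω} (hu : u ∈ H10 Ω)
    (hg : grad u = 0) : toL2 u = 0 := by
  have hb : ∀ R : ℝ, 0 < R → ‖toL2 u‖ ^ 2 ≤
      volume.real (Metric.ball (0 : E) R) * (volume.real Ω * ‖toL2 u‖ ^ 2) := by
    intro R hR
    have h := norm_sq_le_integral_spectralDensity_add hu hR
    rw [hg, norm_zero, zero_pow two_ne_zero, zero_div, add_zero] at h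
    refine h.trans ((integral_mono (integrableOn_spectralDensity _ R)
      (integrableOn_const Metric.isBounded_ball.measure_lt_top.ne)
      fun ξ => spectralDensity_le _ ξ).trans (le_of_eq ?_))
    simp
  have hlim : Filter.Tendsto (fun R : ℝ => volume.real (Metric.ball (0 : E) R)
      * (volume.real Ω * ‖toL2 u‖ ^ 2)) (nhdsWithin 0 (Set.Ioi 0)) (nhds 0) := by
    have h1 : Filter.Tendsto (fun R : ℝ => R ^ Module.finrank ℝ E
        * volume.real (Metric.ball (0 : E) 1) * (volume.real Ω * ‖toL2 u‖ ^ 2))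
        (nhdsWithin 0 (Set.Ioi 0)) (nhds 0) := by
      have : Continuous (fun R : ℝ => R ^ Module.finrank ℝ E
        * volume.real (Metric.ball (0 : E) 1) * (volume.real Ω * ‖toL2 u‖ ^ 2)) := by fun_prop
      have h := this.tendsto 0
      simp only [zero_pow (Module.finrank_pos (R := ℝ) (M := E)).ne', zero_mul] at h
      exact h.mono_left nhdsWithin_le_nhds
    refine h1.congr' ?_
    filter_upwards [self_mem_nhdsWithin] with R hR
    congr 1
    rw [Measure.real, Measure.real, Measure.addHaar_ball _ _ (le_of_lt hR),
      ENNReal.toReal_mul, ENNReal.toReal_ofReal (pow_nonneg (le_of_lt hR) _)]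
  have := ge_of_tendsto hlim (by
    filter_upwards [self_mem_nhdsWithin] with R hR using hb R hR)
  exact norm_eq_zero.mp (pow_eq_zero_iff two_ne_zero |>.mp (le_antisymm this (by positivity)))

end LowFrequency

/-! ### Tensor products of square integrable functions -/

section Tensor

variable {E₁ E₂ : Type*}
  [NormedAddCommGroup E₁] [InnerProductSpace ℝ E₁] [FiniteDimensional ℝ E₁]
  [MeasurableSpace E₁] [BorelSpace E₁]
  [NormedAddCommGroup E₂] [InnerProductSpace ℝ E₂] [FiniteDimensional ℝ E₂]
  [MeasurableSpace E₂] [BorelSpace E₂]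
  {Ω₁ : Set E₁} {Ω₂ : Set E₂}

lemma measurePreserving_ofLp_restrict (Ω₁ : Set E₁) (Ω₂ : Set E₂) :
    MeasurePreserving (WithLp.ofLp : WithLp 2 (E₁ × E₂) → E₁ × E₂)
      (volume.restrict (prodRegion Ω₁ Ω₂)) ((volume.restrict Ω₁).prod (volume.restrict Ω₂)) := by
  rw [Measure.prod_restrict]
  exact (WithLp.volume_preserving_ofLp E₁ E₂).restrict_preimage_emb
    (MeasurableEquiv.toLp 2 (E₁ × E₂)).symm.measurableEmbedding (Ω₁ ×ˢ Ω₂)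

lemma integral_prodRegion {F : Type*} [NormedAddCommGroup F] [NormedSpace ℝ F]
    (f : WithLp 2 (E₁ × E₂) → F) :
    ∫ z in prodRegion Ω₁ Ω₂, f z
      = ∫ z, f (WithLp.toLp 2 z) ∂((volume.restrict Ω₁).prod (volume.restrict Ω₂)) :=
  (measurePreserving_ofLp_restrict Ω₁ Ω₂).integral_comp
    (MeasurableEquiv.toLp 2 (E₁ × E₂)).symm.measurableEmbedding fun z => f (WithLp.toLp 2 z)

lemma integrable_prodRegion {F : Type*} [NormedAddCommGroup F] {f : WithLp 2 (E₁ × E₂) → F} :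
    Integrable f (volume.restrict (prodRegion Ω₁ Ω₂)) ↔
      Integrable (fun z => f (WithLp.toLp 2 z))
        ((volume.restrict Ω₁).prod (volume.restrict Ω₂)) :=
  (measurePreserving_ofLp_restrict Ω₁ Ω₂).integrable_comp_emb
    (MeasurableEquiv.toLp 2 (E₁ × E₂)).symm.measurableEmbedding
    (g := fun z => f (WithLp.toLp 2 z))

lemma quasiMeasurePreserving_fst_prodRegion (Ω₁ : Set E₁) (Ω₂ : Set E₂) :
    Measure.QuasiMeasurePreserving (fun z : WithLp 2 (E₁ × E₂) => z.fst)
      (volume.restrict (prodRegion Ω₁ Ω₂)) (volume.restrict Ω₁) :=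
  Measure.quasiMeasurePreserving_fst.comp
    (measurePreserving_ofLp_restrict Ω₁ Ω₂).quasiMeasurePreserving

lemma quasiMeasurePreserving_snd_prodRegion (Ω₁ : Set E₁) (Ω₂ : Set E₂) :
    Measure.QuasiMeasurePreserving (fun z : WithLp 2 (E₁ × E₂) => z.snd)
      (volume.restrict (prodRegion Ω₁ Ω₂)) (volume.restrict Ω₂) :=
  Measure.quasiMeasurePreserving_snd.comp
    (measurePreserving_ofLp_restrict Ω₁ Ω₂).quasiMeasurePreserving

lemma norm_sq_eq_integral {X F : Type*} [MeasurableSpace X] {m : Measure X}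
    [NormedAddCommGroup F] [InnerProductSpace ℝ F] (f : Lp F 2 m) :
    ‖f‖ ^ 2 = ∫ x, ‖f x‖ ^ 2 ∂m := by
  rw [← real_inner_self_eq_norm_sq, L2.inner_def]
  simp_rw [real_inner_self_eq_norm_sq]

variable {F₁ F₂ F₃ : Type*}
  [NormedAddCommGroup F₁] [InnerProductSpace ℝ F₁]
  [NormedAddCommGroup F₂] [InnerProductSpace ℝ F₂]
  [NormedAddCommGroup F₃] [InnerProductSpace ℝ F₃]

lemma integrable_norm_sq_mul_norm_sq (f : Lp F₁ 2 (volume.restrict Ω₁))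
    (g : Lp F₂ 2 (volume.restrict Ω₂)) :
    Integrable (fun z : WithLp 2 (E₁ × E₂) => ‖f z.fst‖ ^ 2 * ‖g z.snd‖ ^ 2)
      (volume.restrict (prodRegion Ω₁ Ω₂)) :=
  integrable_prodRegion.mpr
    ((Lp.memLp f).norm.integrable_sq.mul_prod (Lp.memLp g).norm.integrable_sq)

lemma memLp_tensor (B : F₁ →L[ℝ] F₂ →L[ℝ] F₃) (f : Lp F₁ 2 (volume.restrict Ω₁))
    (g : Lp F₂ 2 (volume.restrict Ω₂)) :
    MemLp (fun z : WithLp 2 (E₁ × E₂) => B (f z.fst) (g z.snd)) 2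
      (volume.restrict (prodRegion Ω₁ Ω₂)) := by
  have hm : AEStronglyMeasurable (fun z : WithLp 2 (E₁ × E₂) => B (f z.fst) (g z.snd))
      (volume.restrict (prodRegion Ω₁ Ω₂)) :=
    B.aestronglyMeasurable_comp₂
      ((Lp.aestronglyMeasurable f).comp_quasiMeasurePreserving
        (quasiMeasurePreserving_fst_prodRegion Ω₁ Ω₂))
      ((Lp.aestronglyMeasurable g).comp_quasiMeasurePreserving
        (quasiMeasurePreserving_snd_prodRegion Ω₁ Ω₂))
  refine (memLp_two_iff_integrable_sq_norm hm).mpr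
    (((integrable_norm_sq_mul_norm_sq f g).const_mul (‖B‖ ^ 2)).mono' (hm.norm.pow 2)
      (.of_forall fun z => ?_))
  rw [Real.norm_of_nonneg (by positivity), ← mul_pow, ← mul_pow, ← mul_assoc]
  gcongr
  exact B.le_opNorm₂ _ _

/-- The bounded bilinear map `L²(Ω₁) × L²(Ω₂) → L²(Ω₁ × Ω₂)` that sends `f`, `g` to
`(x, y) ↦ B (f x) (g y)`, for a bilinear pairing `B` of the spaces of values. -/
def tensor (Ω₁ : Set E₁) (Ω₂ : Set E₂) (B : F₁ →L[ℝ] F₂ →L[ℝ] F₃) :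
    Lp F₁ 2 (volume.restrict Ω₁) →L[ℝ] Lp F₂ 2 (volume.restrict Ω₂) →L[ℝ]
      Lp F₃ 2 (volume.restrict (prodRegion Ω₁ Ω₂)) :=
  LinearMap.mkContinuous₂
    (LinearMap.mk₂ ℝ (fun f g => (memLp_tensor B f g).toLp)
      (by
        intro f f' g
        rw [← MemLp.toLp_add]
        refine MemLp.toLp_congr _ _ ?_
        filter_upwards [(quasiMeasurePreserving_fst_prodRegion Ω₁ Ω₂).ae_eq_comp
          (Lp.coeFn_add f f')] with z hz
        simp only [Function.comp_apply] at hz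
        rw [hz]
        simp only [Pi.add_apply, map_add, add_apply])
      (by
        intro c f g
        rw [← MemLp.toLp_const_smul]
        refine MemLp.toLp_congr _ _ ?_
        filter_upwards [(quasiMeasurePreserving_fst_prodRegion Ω₁ Ω₂).ae_eq_comp
          (Lp.coeFn_smul c f)] with z hz
        simp only [Function.comp_apply] at hz
        simp [hz])
      (by
        intro f g g'
        rw [← MemLp.toLp_add]
        refine MemLp.toLp_congr _ _ ?_
        filter_upwards [(quasiMeasurePreserving_snd_prodRegion Ω₁ Ω₂).ae_eq_comp
          (Lp.coeFn_add g g')] with z hz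
        simp only [Function.comp_apply] at hz
        rw [hz]
        simp only [Pi.add_apply, map_add])
      (by
        intro c f g
        rw [← MemLp.toLp_const_smul]
        refine MemLp.toLp_congr _ _ ?_
        filter_upwards [(quasiMeasurePreserving_snd_prodRegion Ω₁ Ω₂).ae_eq_comp
          (Lp.coeFn_smul c g)] with z hz
        simp only [Function.comp_apply] at hz
        simp [hz]))
    ‖B‖
    (by
      intro f g
      refine le_of_sq_le_sq ?_ (by positivity)
      rw [LinearMap.mk₂_apply, norm_sq_eq_integral, mul_pow, mul_pow, norm_sq_eq_integral f,
        norm_sq_eq_integral g, mul_assoc, ← integral_prod_mul, ← integral_const_mul]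
      refine le_of_le_of_eq ?_ (integral_prodRegion (Ω₁ := Ω₁) (Ω₂ := Ω₂)
        fun z => ‖B‖ ^ 2 * (‖f z.fst‖ ^ 2 * ‖g z.snd‖ ^ 2))
      refine integral_mono_ae (Lp.memLp _).norm.integrable_sq
        ((integrable_norm_sq_mul_norm_sq f g).const_mul (‖B‖ ^ 2)) ?_
      filter_upwards [(memLp_tensor B f g).coeFn_toLp] with z hz
      rw [hz, ← mul_pow, ← mul_pow, ← mul_assoc]
      gcongr
      exact B.le_opNorm₂ _ _)

lemma coeFn_tensor (B : F₁ →L[ℝ] F₂ →L[ℝ] F₃) (f : Lp F₁ 2 (volume.restrict Ω₁))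
    (g : Lp F₂ 2 (volume.restrict Ω₂)) :
    tensor Ω₁ Ω₂ B f g =ᵐ[volume.restrict (prodRegion Ω₁ Ω₂)]
      fun z => B (f z.fst) (g z.snd) :=
  (memLp_tensor B f g).coeFn_toLp

lemma inner_tensor_eq_integral (B : F₁ →L[ℝ] F₂ →L[ℝ] F₃) (f : Lp F₁ 2 (volume.restrict Ω₁))
    (g : Lp F₂ 2 (volume.restrict Ω₂)) {h : Lp F₃ 2 (volume.restrict (prodRegion Ω₁ Ω₂))}
    {H : WithLp 2 (E₁ × E₂) → F₃} (hH : h =ᵐ[volume.restrict (prodRegion Ω₁ Ω₂)] H) :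
    Integrable (fun z : E₁ × E₂ => ⟪B (f z.1) (g z.2), H (WithLp.toLp 2 z)⟫)
        ((volume.restrict Ω₁).prod (volume.restrict Ω₂)) ∧
      ⟪tensor Ω₁ Ω₂ B f g, h⟫ = ∫ z : E₁ × E₂, ⟪B (f z.1) (g z.2), H (WithLp.toLp 2 z)⟫
        ∂((volume.restrict Ω₁).prod (volume.restrict Ω₂)) := by
  have hae : (fun z => ⟪tensor Ω₁ Ω₂ B f g z, h z⟫) =ᵐ[volume.restrict (prodRegion Ω₁ Ω₂)]
      fun z => ⟪B (f z.fst) (g z.snd), H z⟫ := by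
    filter_upwards [coeFn_tensor B f g, hH] with z h1 h2
    rw [h1, h2]
  constructor
  · exact integrable_prodRegion.mp ((L2.integrable_inner (𝕜 := ℝ) _ _).congr hae)
  · rw [L2.inner_def, integral_congr_ae hae, integral_prodRegion]
    rfl

/-- The tensor product `f ⊗ g` of two functions in `L²`. -/
abbrev mulTensor (Ω₁ : Set E₁) (Ω₂ : Set E₂) : L2 Ω₁ →L[ℝ] L2 Ω₂ →L[ℝ] L2 (prodRegion Ω₁ Ω₂) :=
  tensor Ω₁ Ω₂ (ContinuousLinearMap.mul ℝ ℝ)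

lemma inner_mulTensor_mulTensor (f f' : L2 Ω₁) (g g' : L2 Ω₂) :
    ⟪mulTensor Ω₁ Ω₂ f g, mulTensor Ω₁ Ω₂ f' g'⟫ = ⟪f, f'⟫ * ⟪g, g'⟫ := by
  rw [(inner_tensor_eq_integral _ f g (coeFn_tensor _ f' g')).2, ← integral_mul_eq_inner,
    ← integral_mul_eq_inner, ← integral_prod_mul]
  refine integral_congr_ae (.of_forall fun z => ?_)
  simp
  ring

/-- The products of the members of two orthonormal bases are complete in `L²(Ω₁ × Ω₂)`. If `h` is
orthogonal to all of them, then by continuity it is orthogonal to `f ⊗ b k` for every `f`, so that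
for almost every `x` all the coefficients of `h (x, ·)` in the basis `b` are zero. -/
theorem eq_zero_of_forall_inner_mulTensor_eq_zero [IsFiniteMeasure (volume.restrict Ω₁)]
    {ι κ : Type*} [Countable κ] (a : HilbertBasis ι ℝ (L2 Ω₁)) (b : HilbertBasis κ ℝ (L2 Ω₂))
    {h : L2 (prodRegion Ω₁ Ω₂)} (hh : ∀ j k, ⟪mulTensor Ω₁ Ω₂ (a j) (b k), h⟫ = 0) : h = 0 := by
  set μ := volume.restrict Ω₁
  set ν := volume.restrict Ω₂
  have h1 : ∀ (f : L2 Ω₁) (k : κ), ⟪mulTensor Ω₁ Ω₂ f (b k), h⟫ = 0 := by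
    intro f k
    have hd : Dense (Submodule.span ℝ (Set.range a) : Set (L2 Ω₁)) :=
      Submodule.dense_iff_topologicalClosure_eq_top.mpr a.dense_span
    have := ContinuousLinearMap.ext_on hd
      (f := (innerSL ℝ h).comp ((mulTensor Ω₁ Ω₂).flip (b k))) (g := 0) (by
        rintro _ ⟨j, rfl⟩
        simpa [real_inner_comm] using hh j k)
    have := congrArg (fun L => L f) this
    simpa [real_inner_comm] using this
  have h2 : ∀ᵐ x ∂μ, ∀ k, ∫ y, b k y * h (WithLp.toLp 2 (x, y)) ∂ν = 0 := by
    refine ae_all_iff.mpr fun k => ?_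
    -- The coefficient `x ↦ ∫ b k y * h (x, y) dy` is integrable, and its integral over a measurable
    -- set `s` is the inner product of `h` with `1_s ⊗ b k`.
    have hone : ∀ s : Set E₁, MeasurableSet s → μ s ≠ ⊤ := fun s _ => measure_ne_top μ s
    have hI : ∀ s (hs : MeasurableSet s),
        Integrable (fun z : E₁ × E₂ => s.indicator (fun _ => (1 : ℝ)) z.1 *
          (b k z.2 * h (WithLp.toLp 2 z))) (μ.prod ν) ∧
        ∫ z : E₁ × E₂, s.indicator (fun _ => (1 : ℝ)) z.1 * (b k z.2 * h (WithLp.toLp 2 z))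
          ∂(μ.prod ν) = 0 := by
      intro s hs
      have hae : (fun z : E₁ × E₂ => ⟪(ContinuousLinearMap.mul ℝ ℝ)
          (indicatorConstLp 2 hs (hone s hs) (1 : ℝ) z.1) (b k z.2), h (WithLp.toLp 2 z)⟫)
          =ᵐ[μ.prod ν] fun z => s.indicator (fun _ => (1 : ℝ)) z.1 *
            (b k z.2 * h (WithLp.toLp 2 z)) := by
        filter_upwards [(Measure.quasiMeasurePreserving_fst (μ := μ) (ν := ν)).ae_eq_comp
          (indicatorConstLp_coeFn (p := 2) (hs := hs) (hμs := hone s hs) (c := (1 : ℝ)))] with z hz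
        simp only [Function.comp_apply] at hz
        rw [hz]
        simp
        ring
      obtain ⟨hi, he⟩ := inner_tensor_eq_integral (ContinuousLinearMap.mul ℝ ℝ)
        (indicatorConstLp 2 hs (hone s hs) (1 : ℝ)) (b k) (h := h) (H := h) .rfl
      exact ⟨hi.congr hae, (integral_congr_ae hae).symm.trans (he.symm.trans (h1 _ k))⟩
    have hint : Integrable (fun z : E₁ × E₂ => b k z.2 * h (WithLp.toLp 2 z)) (μ.prod ν) := by
      simpa using (hI Set.univ .univ).1
    refine Integrable.ae_eq_zero_of_forall_setIntegral_eq_zero hint.integral_prod_left ?_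
    intro s hs _
    have := (hI s hs).2
    rw [integral_prod _ (hI s hs).1] at this
    simp_rw [integral_const_mul] at this
    rw [← integral_indicator hs, ← this]
    refine integral_congr_ae (.of_forall fun x => ?_)
    by_cases hx : x ∈ s <;> simp [hx]
  have hsq : Integrable (fun z : E₁ × E₂ => ‖h (WithLp.toLp 2 z)‖ ^ 2) (μ.prod ν) :=
    integrable_prodRegion.mp (Lp.memLp h).norm.integrable_sq
  have hm : AEStronglyMeasurable (fun z : E₁ × E₂ => h (WithLp.toLp 2 z)) (μ.prod ν) :=
    ((measurePreserving_ofLp_restrict Ω₁ Ω₂).aestronglyMeasurable_comp_iff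
      (MeasurableEquiv.toLp 2 (E₁ × E₂)).symm.measurableEmbedding
      (g := fun z => h (WithLp.toLp 2 z))).mp (Lp.aestronglyMeasurable h)
  have h3 : ∀ᵐ x ∂μ, ∫ y, ‖h (WithLp.toLp 2 (x, y))‖ ^ 2 ∂ν = 0 := by
    filter_upwards [h2, hsq.prod_right_ae, hm.prodMk_left] with x hx hxi hxm
    have hL : MemLp (fun y => h (WithLp.toLp 2 (x, y))) 2 ν :=
      (memLp_two_iff_integrable_sq_norm hxm).mpr hxi
    have hzero : hL.toLp = 0 := by
      rw [← b.repr.map_eq_zero_iff]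
      ext k
      rw [b.repr_apply_apply, ← integral_mul_eq_inner]
      refine Eq.trans (integral_congr_ae ?_) (hx k)
      filter_upwards [hL.coeFn_toLp] with y hy
      rw [hy]
    have : (fun y => h (WithLp.toLp 2 (x, y))) =ᵐ[ν] 0 :=
      hL.coeFn_toLp.symm.trans (hzero ▸ Lp.coeFn_zero ℝ 2 ν)
    refine integral_eq_zero_of_ae ?_
    filter_upwards [this] with y hy
    simp [hy]
  have h4 : ‖h‖ ^ 2 = 0 := by
    rw [norm_sq_eq_integral, integral_prodRegion, integral_prod _ hsq]
    exact integral_eq_zero_of_ae h3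
  exact norm_eq_zero.mp (pow_eq_zero_iff two_ne_zero |>.mp h4)

end Tensor

/-! ### Dyads of Sobolev functions -/

section Dyad

variable {E₁ E₂ : Type*}
  [NormedAddCommGroup E₁] [InnerProductSpace ℝ E₁] [FiniteDimensional ℝ E₁]
  [MeasurableSpace E₁] [BorelSpace E₁]
  [NormedAddCommGroup E₂] [InnerProductSpace ℝ E₂] [FiniteDimensional ℝ E₂]
  [MeasurableSpace E₂] [BorelSpace E₂]
  {Ω₁ : Set E₁} {Ω₂ : Set E₂}

lemma isOpen_prodRegion (h₁ : IsOpen Ω₁) (h₂ : IsOpen Ω₂) : IsOpen (prodRegion Ω₁ Ω₂) :=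
  (h₁.preimage (WithLp.fstL 2 ℝ E₁ E₂).continuous).inter
    (h₂.preimage (WithLp.sndL 2 ℝ E₁ E₂).continuous)

lemma hasGradientAt_mul_prod {φ : E₁ → ℝ} {ψ : E₂ → ℝ} {z : WithLp 2 (E₁ × E₂)}
    (hφ : DifferentiableAt ℝ φ z.fst) (hψ : DifferentiableAt ℝ ψ z.snd) :
    HasGradientAt (fun z : WithLp 2 (E₁ × E₂) => φ z.fst * ψ z.snd)
      (WithLp.toLp 2 (ψ z.snd • gradient φ z.fst, φ z.fst • gradient ψ z.snd)) z := by
  rw [hasGradientAt_iff_hasFDerivAt]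
  have h1 : HasFDerivAt (fun z : WithLp 2 (E₁ × E₂) => φ z.fst)
      ((fderiv ℝ φ z.fst).comp (WithLp.fstL 2 ℝ E₁ E₂)) z :=
    hφ.hasFDerivAt.comp z (WithLp.fstL 2 ℝ E₁ E₂).hasFDerivAt
  have h2 : HasFDerivAt (fun z : WithLp 2 (E₁ × E₂) => ψ z.snd)
      ((fderiv ℝ ψ z.snd).comp (WithLp.sndL 2 ℝ E₁ E₂)) z :=
    hψ.hasFDerivAt.comp z (WithLp.sndL 2 ℝ E₁ E₂).hasFDerivAt
  refine (h1.mul h2).congr_fderiv (ContinuousLinearMap.ext fun v => ?_)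
  rw [InnerProductSpace.toDual_apply_apply, WithLp.prod_inner_apply]
  simp [real_inner_smul_left, inner_gradient_left]
  ring

lemma IsTestFunction.mul_prod {φ : E₁ → ℝ} {ψ : E₂ → ℝ} (hφ : IsTestFunction Ω₁ φ)
    (hψ : IsTestFunction Ω₂ ψ) :
    IsTestFunction (prodRegion Ω₁ Ω₂) fun z => φ z.fst * ψ z.snd := by
  have hK : IsCompact {z : WithLp 2 (E₁ × E₂) | z.fst ∈ tsupport φ ∧ z.snd ∈ tsupport ψ} :=
    (WithLp.homeomorphProd 2 E₁ E₂).isCompact_preimage.mpr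
      (hφ.hasCompactSupport.isCompact.prod hψ.hasCompactSupport.isCompact)
  have hs : Function.support (fun z : WithLp 2 (E₁ × E₂) => φ z.fst * ψ z.snd)
      ⊆ {z | z.fst ∈ tsupport φ ∧ z.snd ∈ tsupport ψ} := fun z hz =>
    ⟨subset_tsupport _ (left_ne_zero_of_mul hz), subset_tsupport _ (right_ne_zero_of_mul hz)⟩
  refine ⟨?_, HasCompactSupport.of_support_subset_isCompact hK hs, ?_⟩
  · exact (hφ.contDiff.comp (WithLp.fstL 2 ℝ E₁ E₂).contDiff).mul
      (hψ.contDiff.comp (WithLp.sndL 2 ℝ E₁ E₂).contDiff)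
  · exact (closure_minimal hs hK.isClosed).trans
      fun z hz => ⟨hφ.tsupport_subset hz.1, hψ.tsupport_subset hz.2⟩

/-- The pairing `(a, t) ↦ (t a, 0)`, for the part `f ∇e` of the gradient of a dyad `e ⊗ f`. -/
def fstPairing (E₁ E₂ : Type*) [NormedAddCommGroup E₁] [InnerProductSpace ℝ E₁]
    [NormedAddCommGroup E₂] [InnerProductSpace ℝ E₂] : E₁ →L[ℝ] ℝ →L[ℝ] WithLp 2 (E₁ × E₂) :=
  (ContinuousLinearMap.lsmul ℝ ℝ).flip.comp
    ((WithLp.prodContinuousLinearEquiv 2 ℝ E₁ E₂).symm.toContinuousLinearMap.comp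
      (ContinuousLinearMap.inl ℝ E₁ E₂))

/-- The pairing `(t, b) ↦ (0, t b)`, for the part `e ∇f` of the gradient of a dyad `e ⊗ f`. -/
def sndPairing (E₁ E₂ : Type*) [NormedAddCommGroup E₁] [InnerProductSpace ℝ E₁]
    [NormedAddCommGroup E₂] [InnerProductSpace ℝ E₂] : ℝ →L[ℝ] E₂ →L[ℝ] WithLp 2 (E₁ × E₂) :=
  ((ContinuousLinearMap.lsmul ℝ ℝ).flip.comp
    ((WithLp.prodContinuousLinearEquiv 2 ℝ E₁ E₂).symm.toContinuousLinearMap.comp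
      (ContinuousLinearMap.inr ℝ E₁ E₂))).flip

lemma fstPairing_apply (a : E₁) (t : ℝ) :
    fstPairing E₁ E₂ a t = WithLp.toLp 2 (t • a, (0 : E₂)) := by
  refine WithLp.ofLp_injective 2 ?_
  simp [fstPairing]

lemma sndPairing_apply (t : ℝ) (b : E₂) :
    sndPairing E₁ E₂ t b = WithLp.toLp 2 ((0 : E₁), t • b) := by
  refine WithLp.ofLp_injective 2 ?_
  simp [sndPairing]

/-- The gradient `(f ∇e, e ∇f)` of the dyad `e ⊗ f`. -/
def dyadGrad (e : H1 Ω₁) (f : H1 Ω₂) : L2Vec (prodRegion Ω₁ Ω₂) :=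
  tensor Ω₁ Ω₂ (fstPairing E₁ E₂) (grad e) (toL2 f)
    + tensor Ω₁ Ω₂ (sndPairing E₁ E₂) (toL2 e) (grad f)

/-- The dyad `e ⊗ f` with its gradient, as an element of `L² × L²`. For factors in `H₀¹` it lies in
`H¹`, see `exists_mem_H10_dyad`. -/
def dyadPair (e : H1 Ω₁) (f : H1 Ω₂) :
    WithLp 2 (L2 (prodRegion Ω₁ Ω₂) × L2Vec (prodRegion Ω₁ Ω₂)) :=
  WithLp.toLp 2 (mulTensor Ω₁ Ω₂ (toL2 e) (toL2 f), dyadGrad e f)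

lemma continuous_dyadPair_left (f : H1 Ω₂) : Continuous fun e : H1 Ω₁ => dyadPair e f := by
  have h1 := (toL2L Ω₁).continuous
  have h2 := (gradL Ω₁).continuous
  refine (WithLp.prod_continuous_toLp 2 _ _).comp (Continuous.prodMk ?_ (Continuous.add ?_ ?_))
  · exact (((mulTensor Ω₁ Ω₂).flip (toL2 f)).continuous).comp h1
  · exact (((tensor Ω₁ Ω₂ (fstPairing E₁ E₂)).flip (toL2 f)).continuous).comp h2
  · exact (((tensor Ω₁ Ω₂ (sndPairing E₁ E₂)).flip (grad f)).continuous).comp h1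

lemma continuous_dyadPair_right (e : H1 Ω₁) : Continuous fun f : H1 Ω₂ => dyadPair e f := by
  have h1 := (toL2L Ω₂).continuous
  have h2 := (gradL Ω₂).continuous
  refine (WithLp.prod_continuous_toLp 2 _ _).comp (Continuous.prodMk ?_ (Continuous.add ?_ ?_))
  · exact ((mulTensor Ω₁ Ω₂ (toL2 e)).continuous).comp h1
  · exact ((tensor Ω₁ Ω₂ (fstPairing E₁ E₂) (grad e)).continuous).comp h1
  · exact ((tensor Ω₁ Ω₂ (sndPairing E₁ E₂) (toL2 e)).continuous).comp h2

lemma IsTestClass.exists_dyad {e : H1 Ω₁} {f : H1 Ω₂} {φ : E₁ → ℝ} {ψ : E₂ → ℝ}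
    (he : IsTestClass e φ) (hf : IsTestClass f ψ) :
    dyadPair e f ∈ Subtype.val '' (H10 (prodRegion Ω₁ Ω₂) : Set (H1 (prodRegion Ω₁ Ω₂))) := by
  obtain ⟨u, hu⟩ := (he.1.mul_prod hf.1).exists_isTestClass
  refine ⟨u, mem_H10_of_isTestClass hu, WithLp.ofLp_injective 2 (Prod.ext ?_ ?_)⟩
  · refine Lp.ext ?_
    filter_upwards [hu.2.1, coeFn_tensor (ContinuousLinearMap.mul ℝ ℝ) (toL2 e) (toL2 f),
      (quasiMeasurePreserving_fst_prodRegion Ω₁ Ω₂).ae_eq_comp he.2.1,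
      (quasiMeasurePreserving_snd_prodRegion Ω₁ Ω₂).ae_eq_comp hf.2.1] with z h1 h2 h3 h4
    refine h1.trans (Eq.trans ?_ h2.symm)
    simp only [Function.comp_apply] at h3 h4
    rw [h3, h4]
    rfl
  · refine Lp.ext ?_
    filter_upwards [hu.2.2, Lp.coeFn_add (tensor Ω₁ Ω₂ (fstPairing E₁ E₂) (grad e) (toL2 f))
        (tensor Ω₁ Ω₂ (sndPairing E₁ E₂) (toL2 e) (grad f)),
      coeFn_tensor (fstPairing E₁ E₂) (grad e) (toL2 f),
      coeFn_tensor (sndPairing E₁ E₂) (toL2 e) (grad f),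
      (quasiMeasurePreserving_fst_prodRegion Ω₁ Ω₂).ae_eq_comp he.2.1,
      (quasiMeasurePreserving_snd_prodRegion Ω₁ Ω₂).ae_eq_comp hf.2.1,
      (quasiMeasurePreserving_fst_prodRegion Ω₁ Ω₂).ae_eq_comp he.2.2,
      (quasiMeasurePreserving_snd_prodRegion Ω₁ Ω₂).ae_eq_comp hf.2.2]
      with z h1 h2 h3 h4 h5 h6 h7 h8
    refine h1.trans (Eq.trans ?_ h2.symm)
    simp only [Function.comp_apply] at h5 h6 h7 h8
    rw [Pi.add_apply, h3, h4, h5, h6, h7, h8, fstPairing_apply, sndPairing_apply,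
      (hasGradientAt_mul_prod (he.1.contDiff.differentiable (by simp)).differentiableAt
        (hf.1.contDiff.differentiable (by simp)).differentiableAt).gradient]
    refine WithLp.ofLp_injective 2 ?_
    simp

/-- The dyad of two functions in `H₀¹` is in `H₀¹` of the product region: it depends continuously
on each factor, and dyads of test functions are test functions. -/
theorem exists_mem_H10_dyad {e : H1 Ω₁} {f : H1 Ω₂} (he : e ∈ H10 Ω₁) (hf : f ∈ H10 Ω₂) :
    ∃ u ∈ H10 (prodRegion Ω₁ Ω₂),
      toL2 u = mulTensor Ω₁ Ω₂ (toL2 e) (toL2 f) ∧ grad u = dyadGrad e f := by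
  set S : Set (WithLp 2 (L2 (prodRegion Ω₁ Ω₂) × L2Vec (prodRegion Ω₁ Ω₂))) :=
    Subtype.val '' (H10 (prodRegion Ω₁ Ω₂) : Set (H1 (prodRegion Ω₁ Ω₂)))
  have hS : IsClosed S :=
    (isClosed_H1 _).isClosedEmbedding_subtypeVal.isClosedMap _ (isClosed_H10 _)
  have h : dyadPair e f ∈ S := by
    refine H10_induction (s := {e | dyadPair e f ∈ S})
      (hS.preimage (continuous_dyadPair_left f)) (fun e φ he => ?_) he
    exact H10_induction (s := {f | dyadPair e f ∈ S})
      (hS.preimage (continuous_dyadPair_right e)) (fun f ψ hf => he.exists_dyad hf) hf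
  obtain ⟨u, hu, hu'⟩ := h
  exact ⟨u, hu, congrArg WithLp.fst hu', congrArg WithLp.snd hu'⟩

/-! ### The eigenvalue equation for dyads -/

variable {Φ : WithLp 2 (E₁ × E₂) → ℝ}

lemma IsTestFunction.slice_left (h : IsTestFunction (prodRegion Ω₁ Ω₂) Φ) (y : E₂) :
    IsTestFunction Ω₁ fun x => Φ (WithLp.toLp 2 (x, y)) := by
  have hc : Continuous fun x : E₁ => (WithLp.toLp 2 (x, y) : WithLp 2 (E₁ × E₂)) :=
    (WithLp.prod_continuous_toLp 2 E₁ E₂).comp (by fun_prop)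
  have hcl : IsClosed {x : E₁ | (WithLp.toLp 2 (x, y) : WithLp 2 (E₁ × E₂)) ∈ tsupport Φ} :=
    (isClosed_tsupport Φ).preimage hc
  have hK : IsCompact {x : E₁ | (WithLp.toLp 2 (x, y) : WithLp 2 (E₁ × E₂)) ∈ tsupport Φ} :=
    (h.hasCompactSupport.isCompact.image (WithLp.fstL 2 ℝ E₁ E₂).continuous).of_isClosed_subset hcl
      fun x hx => ⟨_, hx, rfl⟩
  have hs : Function.support (fun x => Φ (WithLp.toLp 2 (x, y)))
      ⊆ {x : E₁ | (WithLp.toLp 2 (x, y) : WithLp 2 (E₁ × E₂)) ∈ tsupport Φ} :=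
    fun x hx => subset_tsupport Φ hx
  refine ⟨?_, HasCompactSupport.of_support_subset_isCompact hK hs, ?_⟩
  · exact h.contDiff.comp ((WithLp.prodContinuousLinearEquiv 2 ℝ E₁ E₂).symm.contDiff.comp
      (contDiff_id.prodMk contDiff_const))
  · exact (closure_minimal hs hcl).trans fun x hx => (h.tsupport_subset hx).1

lemma IsTestFunction.slice_right (h : IsTestFunction (prodRegion Ω₁ Ω₂) Φ) (x : E₁) :
    IsTestFunction Ω₂ fun y => Φ (WithLp.toLp 2 (x, y)) := by
  have hc : Continuous fun y : E₂ => (WithLp.toLp 2 (x, y) : WithLp 2 (E₁ × E₂)) :=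
    (WithLp.prod_continuous_toLp 2 E₁ E₂).comp (by fun_prop)
  have hcl : IsClosed {y : E₂ | (WithLp.toLp 2 (x, y) : WithLp 2 (E₁ × E₂)) ∈ tsupport Φ} :=
    (isClosed_tsupport Φ).preimage hc
  have hK : IsCompact {y : E₂ | (WithLp.toLp 2 (x, y) : WithLp 2 (E₁ × E₂)) ∈ tsupport Φ} :=
    (h.hasCompactSupport.isCompact.image (WithLp.sndL 2 ℝ E₁ E₂).continuous).of_isClosed_subset hcl
      fun y hy => ⟨_, hy, rfl⟩
  have hs : Function.support (fun y => Φ (WithLp.toLp 2 (x, y)))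
      ⊆ {y : E₂ | (WithLp.toLp 2 (x, y) : WithLp 2 (E₁ × E₂)) ∈ tsupport Φ} :=
    fun y hy => subset_tsupport Φ hy
  refine ⟨?_, HasCompactSupport.of_support_subset_isCompact hK hs, ?_⟩
  · exact h.contDiff.comp ((WithLp.prodContinuousLinearEquiv 2 ℝ E₁ E₂).symm.contDiff.comp
      (contDiff_const.prodMk contDiff_id))
  · exact (closure_minimal hs hcl).trans fun y hy => (h.tsupport_subset hy).2

lemma gradient_slice_left (h : Differentiable ℝ Φ) (x : E₁) (y : E₂) :
    gradient (fun x => Φ (WithLp.toLp 2 (x, y))) x = (gradient Φ (WithLp.toLp 2 (x, y))).fst := by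
  refine HasGradientAt.gradient ?_
  rw [hasGradientAt_iff_hasFDerivAt]
  have h1 : HasFDerivAt (fun x : E₁ => (WithLp.toLp 2 (x, y) : WithLp 2 (E₁ × E₂)))
      ((WithLp.prodContinuousLinearEquiv 2 ℝ E₁ E₂).symm.toContinuousLinearMap.comp
        (ContinuousLinearMap.inl ℝ E₁ E₂)) x :=
    (WithLp.prodContinuousLinearEquiv 2 ℝ E₁ E₂).symm.toContinuousLinearMap.hasFDerivAt.comp x
      ((hasFDerivAt_id x).prodMk (hasFDerivAt_const y x))
  refine ((h _).hasFDerivAt.comp x h1).congr_fderiv (ContinuousLinearMap.ext fun v => ?_)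
  have := inner_gradient_left (𝕜 := ℝ) (f := Φ) (x := WithLp.toLp 2 (x, y))
    (y := WithLp.toLp 2 (v, (0 : E₂)))
  rw [WithLp.prod_inner_apply] at this
  simpa using this.symm

lemma gradient_slice_right (h : Differentiable ℝ Φ) (x : E₁) (y : E₂) :
    gradient (fun y => Φ (WithLp.toLp 2 (x, y))) y = (gradient Φ (WithLp.toLp 2 (x, y))).snd := by
  refine HasGradientAt.gradient ?_
  rw [hasGradientAt_iff_hasFDerivAt]
  have h1 : HasFDerivAt (fun y : E₂ => (WithLp.toLp 2 (x, y) : WithLp 2 (E₁ × E₂)))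
      ((WithLp.prodContinuousLinearEquiv 2 ℝ E₁ E₂).symm.toContinuousLinearMap.comp
        (ContinuousLinearMap.inr ℝ E₁ E₂)) y :=
    (WithLp.prodContinuousLinearEquiv 2 ℝ E₁ E₂).symm.toContinuousLinearMap.hasFDerivAt.comp y
      ((hasFDerivAt_const x y).prodMk (hasFDerivAt_id y))
  refine ((h _).hasFDerivAt.comp y h1).congr_fderiv (ContinuousLinearMap.ext fun v => ?_)
  have := inner_gradient_left (𝕜 := ℝ) (f := Φ) (x := WithLp.toLp 2 (x, y))
    (y := WithLp.toLp 2 ((0 : E₁), v))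
  rw [WithLp.prod_inner_apply] at this
  simpa using this.symm

lemma IsDirichletEigenfunction.integral_gradient {E : Type*} [NormedAddCommGroup E]
    [InnerProductSpace ℝ E] [FiniteDimensional ℝ E] [MeasurableSpace E] [BorelSpace E]
    {Ω : Set E} {lam : ℝ} {e : H1 Ω} (he : IsDirichletEigenfunction Ω lam e) {φ : E → ℝ}
    (hφ : IsTestFunction Ω φ) :
    ∫ x in Ω, ⟪grad e x, gradient φ x⟫ = lam * ∫ x in Ω, toL2 e x * φ x := by
  obtain ⟨u, hu⟩ := hφ.exists_isTestClass
  have h := he.eigen u (mem_H10_of_isTestClass hu)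
  have h1 : ∫ x in Ω, ⟪grad e x, grad u x⟫ = ∫ x in Ω, ⟪grad e x, gradient φ x⟫ := by
    refine integral_congr_ae ?_
    filter_upwards [hu.2.2] with x hx
    rw [hx]
  have h2 : ∫ x in Ω, toL2 e x * toL2 u x = ∫ x in Ω, toL2 e x * φ x := by
    refine integral_congr_ae ?_
    filter_upwards [hu.2.1] with x hx
    rw [hx]
  rw [← h1, ← h2, h]

/-- Separation of variables: the eigenvalue equation of `e` on the slices `Φ (·, y)` and that of `f`
on the slices `Φ (x, ·)` give, by Fubini's theorem, that of the dyad `e ⊗ f`. -/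
theorem inner_dyadGrad_grad {lam₁ lam₂ : ℝ} {e : H1 Ω₁} {f : H1 Ω₂}
    (he : IsDirichletEigenfunction Ω₁ lam₁ e) (hf : IsDirichletEigenfunction Ω₂ lam₂ f)
    {h : H1 (prodRegion Ω₁ Ω₂)} (hh : h ∈ H10 (prodRegion Ω₁ Ω₂)) :
    ⟪dyadGrad e f, grad h⟫
      = (lam₁ + lam₂) * ⟪mulTensor Ω₁ Ω₂ (toL2 e) (toL2 f), toL2 h⟫ := by
  refine H10_induction (s := {h | ⟪dyadGrad e f, grad h⟫
      = (lam₁ + lam₂) * ⟪mulTensor Ω₁ Ω₂ (toL2 e) (toL2 f), toL2 h⟫}) ?_ ?_ hh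
  · exact isClosed_eq (continuous_const.inner (gradL _).continuous)
      (continuous_const.mul (continuous_const.inner (toL2L _).continuous))
  intro h Φ hΦ
  have hd : Differentiable ℝ Φ := hΦ.1.contDiff.differentiable (by simp)
  obtain ⟨hi0, he0⟩ := inner_tensor_eq_integral (ContinuousLinearMap.mul ℝ ℝ)
    (toL2 e) (toL2 f) hΦ.2.1
  obtain ⟨hi1, he1⟩ := inner_tensor_eq_integral (fstPairing E₁ E₂) (grad e) (toL2 f) hΦ.2.2
  obtain ⟨hi2, he2⟩ := inner_tensor_eq_integral (sndPairing E₁ E₂) (toL2 e) (grad f) hΦ.2.2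
  have k1 : ⟪tensor Ω₁ Ω₂ (fstPairing E₁ E₂) (grad e) (toL2 f), grad h⟫
      = lam₁ * ⟪mulTensor Ω₁ Ω₂ (toL2 e) (toL2 f), toL2 h⟫ := by
    rw [he1, he0, integral_prod_symm _ hi1, integral_prod_symm _ hi0, ← integral_const_mul]
    refine integral_congr_ae (.of_forall fun y => ?_)
    have := he.integral_gradient (hΦ.1.slice_left y)
    simp_rw [gradient_slice_left hd] at this
    calc ∫ x in Ω₁, ⟪fstPairing E₁ E₂ (grad e x) (toL2 f y), gradient Φ (WithLp.toLp 2 (x, y))⟫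
        = toL2 f y * ∫ x in Ω₁, ⟪grad e x, (gradient Φ (WithLp.toLp 2 (x, y))).fst⟫ := by
          rw [← integral_const_mul]
          refine integral_congr_ae (.of_forall fun x => ?_)
          beta_reduce
          rw [fstPairing_apply, WithLp.prod_inner_apply]
          simp [real_inner_smul_left]
      _ = lam₁ * (toL2 f y * ∫ x in Ω₁, toL2 e x * Φ (WithLp.toLp 2 (x, y))) := by
          rw [this]; ring
      _ = _ := by
          rw [← integral_const_mul]
          congr 1
          refine integral_congr_ae (.of_forall fun x => ?_)
          simp
          ring
  have k2 : ⟪tensor Ω₁ Ω₂ (sndPairing E₁ E₂) (toL2 e) (grad f), grad h⟫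
      = lam₂ * ⟪mulTensor Ω₁ Ω₂ (toL2 e) (toL2 f), toL2 h⟫ := by
    rw [he2, he0, integral_prod _ hi2, integral_prod _ hi0, ← integral_const_mul]
    refine integral_congr_ae (.of_forall fun x => ?_)
    have := hf.integral_gradient (hΦ.1.slice_right x)
    simp_rw [gradient_slice_right hd] at this
    calc ∫ y in Ω₂, ⟪sndPairing E₁ E₂ (toL2 e x) (grad f y), gradient Φ (WithLp.toLp 2 (x, y))⟫
        = toL2 e x * ∫ y in Ω₂, ⟪grad f y, (gradient Φ (WithLp.toLp 2 (x, y))).snd⟫ := by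
          rw [← integral_const_mul]
          refine integral_congr_ae (.of_forall fun y => ?_)
          beta_reduce
          rw [sndPairing_apply, WithLp.prod_inner_apply]
          simp [real_inner_smul_left]
      _ = lam₂ * (toL2 e x * ∫ y in Ω₂, toL2 f y * Φ (WithLp.toLp 2 (x, y))) := by
          rw [this]; ring
      _ = _ := by
          rw [← integral_const_mul]
          congr 1
          refine integral_congr_ae (.of_forall fun y => ?_)
          simp
          ring
  change ⟪dyadGrad e f, grad h⟫ = _
  rw [dyadGrad, inner_add_left, k1, k2, add_mul]

end Dyad

/-! ### Eigenfunction expansions in `H₀¹` -/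

section Expansion

variable {E : Type*} [NormedAddCommGroup E] [InnerProductSpace ℝ E] [FiniteDimensional ℝ E]
  [MeasurableSpace E] [BorelSpace E] {Ω : Set E}

lemma IsDirichletEigenfunction.gradInner_eq {lam : ℝ} {u : H1 Ω}
    (hu : IsDirichletEigenfunction Ω lam u) {h : H1 Ω} (hh : h ∈ H10 Ω) :
    gradInner u h = lam * ⟪toL2 u, toL2 h⟫ := by
  rw [← integral_mul_eq_inner]
  exact hu.eigen h hh

lemma gradInner_comm (u v : H1 Ω) : gradInner u v = gradInner v u := by
  rw [gradInner_eq_inner, gradInner_eq_inner, real_inner_comm]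

lemma gradInner_smul_right (u v : H1 Ω) (c : ℝ) : gradInner u (c • v) = c * gradInner u v := by
  rw [gradInner_eq_inner, gradInner_eq_inner, ← real_inner_smul_right]
  rfl

variable {ι : Type*} {u : ι → H1 Ω} {lam : ι → ℝ}

lemma IsL2OrthonormalBasis.orthonormal (hb : IsL2OrthonormalBasis u) :
    Orthonormal ℝ fun i => toL2 (u i) := by
  obtain ⟨b, hb⟩ := hb
  rw [show (fun i => toL2 (u i)) = b from funext fun i => (hb i).symm]
  exact b.orthonormal

lemma IsL2OrthonormalBasis.eq_zero (hb : IsL2OrthonormalBasis u) {f : L2 Ω}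
    (hf : ∀ i, ⟪toL2 (u i), f⟫ = 0) : f = 0 := by
  obtain ⟨b, hb⟩ := hb
  rw [← b.repr.map_eq_zero_iff]
  ext i
  rw [b.repr_apply_apply, hb, hf]
  rfl

lemma eigenvalue_eq_norm_grad_sq (hu : ∀ i, IsDirichletEigenfunction Ω (lam i) (u i))
    (hb : IsL2OrthonormalBasis u) (i : ι) : lam i = ‖grad (u i)‖ ^ 2 := by
  have h := (hu i).gradInner_eq (hu i).mem_H10
  rw [gradInner_eq_inner, real_inner_self_eq_norm_sq, real_inner_self_eq_norm_sq,
    hb.orthonormal.1 i, one_pow, mul_one] at h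
  exact h.symm

/-- The expansion of `h ∈ H₀¹(Ω)` in an `L²` orthonormal basis of eigenfunctions converges in
`H¹(Ω)`. The eigenvalue equation says that `⟪u i, h⟫` in `H¹` is `1 + lam i` times `⟪u i, h⟫` in
`L²`. So the `u i / √(1 + lam i)` are an orthonormal basis of `H₀¹(Ω)` for the inner product of
`H¹(Ω)`, and the two expansions of `h` agree term by term. -/
theorem hasSum_inner_toL2_smul (hΩ : IsOpen Ω)
    (hu : ∀ i, IsDirichletEigenfunction Ω (lam i) (u i)) (hb : IsL2OrthonormalBasis u)
    {h : H1 Ω} (hh : h ∈ H10 Ω) : HasSum (fun i => ⟪toL2 (u i), toL2 h⟫ • u i) h := by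
  have hpos : ∀ i, 0 < 1 + lam i := fun i => by
    rw [eigenvalue_eq_norm_grad_sq hu hb i]; positivity
  have hinner : ∀ i, ∀ v ∈ H10 Ω, ⟪u i, v⟫ = (1 + lam i) * ⟪toL2 (u i), toL2 v⟫ := by
    intro i v hv
    rw [inner_eq_add_gradInner, (hu i).gradInner_eq hv, add_mul, one_mul]
  set s : ι → ℝ := fun i => (√(1 + lam i))⁻¹
  have hs : ∀ i, s i * s i * (1 + lam i) = 1 := by
    intro i
    rw [← mul_inv, Real.mul_self_sqrt (hpos i).le, inv_mul_cancel₀ (hpos i).ne']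
  have hw : ∀ i, ∀ v ∈ H10 Ω, ⟪s i • u i, v⟫ = s i * ((1 + lam i) * ⟪toL2 (u i), toL2 v⟫) := by
    intro i v hv
    exact (real_inner_smul_left _ _ _).trans (congrArg (s i * ·) (hinner i v hv))
  have hm : ∀ i, s i • u i ∈ H10 Ω := fun i => (H10 Ω).smul_mem _ (hu i).mem_H10
  have ho : Orthonormal ℝ fun i => s i • u i := by
    classical
    rw [orthonormal_iff_ite]
    intro i j
    have h2 : ⟪toL2 (u i), toL2 (s j • u j)⟫ = s j * ⟪toL2 (u i), toL2 (u j)⟫ :=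
      real_inner_smul_right _ _ _
    rw [hw i _ (hm j), h2, orthonormal_iff_ite.mp hb.orthonormal i j]
    split_ifs with hij
    · subst hij
      linear_combination hs i
    · ring
  have hz : ∀ v ∈ H10 Ω, (∀ i, ⟪s i • u i, v⟫ = 0) → v = 0 := by
    intro v hv h0
    refine eq_zero_of_toL2_eq_zero hΩ (hb.eq_zero fun i => ?_)
    have h2 := h0 i
    rw [hw i v hv] at h2
    have h3 : s i ≠ 0 := left_ne_zero_of_mul (left_ne_zero_of_mul ((hs i).trans_ne one_ne_zero))
    simpa [h3, (hpos i).ne'] using h2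
  have hterm : (fun i => ⟪toL2 (u i), toL2 h⟫ • u i)
      = fun i => ⟪s i • u i, h⟫ • (s i • u i) := by
    ext1 i
    rw [hw i h hh, smul_smul]
    congr 1
    linear_combination -⟪toL2 (u i), toL2 h⟫ * hs i
  rw [hterm]
  exact ho.hasSum_inner_smul_of_isClosed (isClosed_H10 Ω) hm hz hh

theorem isGradOrthonormalBasis_of_eigenbasis (hΩ : IsOpen Ω)
    (hu : ∀ i, IsDirichletEigenfunction Ω (lam i) (u i)) (hb : IsL2OrthonormalBasis u)
    (hpos : ∀ i, 0 < lam i) :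
    IsGradOrthonormalBasis fun i => (lam i) ^ (-(1 / 2) : ℝ) • u i := by
  have hc : ∀ i, (lam i) ^ (-(1 / 2) : ℝ) * (lam i) ^ (-(1 / 2) : ℝ) * lam i = 1 := by
    intro i
    rw [← Real.rpow_add (hpos i)]
    norm_num
    rw [Real.rpow_neg_one, inv_mul_cancel₀ (hpos i).ne']
  have hg : ∀ i, ∀ h ∈ H10 Ω, gradInner h ((lam i) ^ (-(1 / 2) : ℝ) • u i)
      = (lam i) ^ (-(1 / 2) : ℝ) * (lam i * ⟪toL2 (u i), toL2 h⟫) := by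
    intro i h hh
    rw [gradInner_smul_right, gradInner_comm, (hu i).gradInner_eq hh]
  have hm : ∀ i, (lam i) ^ (-(1 / 2) : ℝ) • u i ∈ H10 Ω := fun i =>
    (H10 Ω).smul_mem _ (hu i).mem_H10
  have hi : ∀ i j, ⟪toL2 (u i), toL2 ((lam j) ^ (-(1 / 2) : ℝ) • u j)⟫
      = (lam j) ^ (-(1 / 2) : ℝ) * ⟪toL2 (u i), toL2 (u j)⟫ := fun i j =>
    real_inner_smul_right _ _ _
  refine ⟨hm, fun i => ?_, fun i j hij => ?_, fun h hh => ?_⟩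
  · rw [hg i _ (hm i), hi, real_inner_self_eq_norm_sq, hb.orthonormal.1 i]
    linear_combination hc i
  · rw [hg j _ (hm i), hi, hb.orthonormal.2 hij.symm]
    ring
  · convert hasSum_inner_toL2_smul hΩ hu hb hh using 2 with i
    rw [hg i h hh, smul_smul]
    congr 1
    linear_combination ⟪toL2 (u i), toL2 h⟫ * hc i

/-- An eigenfunction with eigenvalue `lam₀` is orthogonal to the members of the eigenbasis with
other eigenvalues, so only the members with eigenvalue `lam₀` occur in its expansion. -/
theorem mem_span_of_isDirichletEigenfunction (hΩ : IsOpen Ω)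
    (hu : ∀ i, IsDirichletEigenfunction Ω (lam i) (u i)) (hb : IsL2OrthonormalBasis u)
    {lam₀ : ℝ} (hfin : {i | lam i = lam₀}.Finite) {v : H1 Ω}
    (hv : IsDirichletEigenfunction Ω lam₀ v) :
    v ∈ Submodule.span ℝ (u '' {i | lam i = lam₀}) := by
  have h0 : ∀ i ∉ hfin.toFinset, ⟪toL2 (u i), toL2 v⟫ • u i = 0 := by
    intro i hi
    have h1 := (hu i).gradInner_eq hv.mem_H10
    have h2 := hv.gradInner_eq (hu i).mem_H10
    rw [gradInner_comm, real_inner_comm, h1] at h2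
    have h3 : (lam i - lam₀) * ⟪toL2 (u i), toL2 v⟫ = 0 := by linear_combination h2
    have h4 : lam i - lam₀ ≠ 0 := sub_ne_zero.mpr fun h => hi (hfin.mem_toFinset.mpr h)
    rw [(mul_eq_zero.mp h3).resolve_left h4, zero_smul]
  rw [(hasSum_inner_toL2_smul hΩ hu hb hv.mem_H10).unique (hasSum_sum_of_ne_finset_zero h0)]
  exact Submodule.sum_mem _ fun i hi => Submodule.smul_mem _ _
    (Submodule.subset_span ⟨i, hfin.mem_toFinset.mp hi, rfl⟩)

variable [IsFiniteMeasure (volume.restrict Ω)]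

lemma finite_setOf_eigenvalue_le (hu : ∀ i, IsDirichletEigenfunction Ω (lam i) (u i))
    (hb : IsL2OrthonormalBasis u) (C : ℝ) : {i | lam i ≤ C}.Finite :=
  have := finite_of_orthonormal_of_norm_grad_sq_le (v := fun i : {i | lam i ≤ C} => u i)
    (fun i => (hu i).mem_H10) (hb.orthonormal.comp _ Subtype.val_injective)
    fun i => (eigenvalue_eq_norm_grad_sq hu hb i).symm.trans_le i.2
  Set.toFinite _

lemma eigenvalue_pos [Infinite ι] (hu : ∀ i, IsDirichletEigenfunction Ω (lam i) (u i))
    (hb : IsL2OrthonormalBasis u) (i : ι) : 0 < lam i := by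
  rw [eigenvalue_eq_norm_grad_sq hu hb i]
  cases subsingleton_or_nontrivial E with
  | inl hE =>
    -- In dimension zero `L²(Ω)` is finite-dimensional and has no infinite orthonormal basis.
    have hg : ∀ i, ‖grad (u i)‖ ^ 2 ≤ 0 := fun i => by
      rw [norm_sq_eq_integral]
      simp [Subsingleton.elim (grad (u i) _) 0]
    exact absurd (finite_of_orthonormal_of_norm_grad_sq_le (fun i => (hu i).mem_H10)
      hb.orthonormal hg) (not_finite_iff_infinite.mpr inferInstance)
  | inr hE =>
    refine pow_pos (norm_pos_iff.mpr fun h => (hu i).ne_zero ?_) 2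
    exact toL2_eq_zero_of_grad_eq_zero (hu i).mem_H10 h

end Expansion

end

end ProductDirichlet

open ProductDirichlet in
theorem theorem3p2 {N₁ N₂ : ℕ}
    (Ω₁ : Set (EuclideanSpace ℝ (Fin N₁))) (Ω₂ : Set (EuclideanSpace ℝ (Fin N₂)))
    (hΩ₁ : ProductDirichlet.B1 Ω₁) (hΩ₂ : ProductDirichlet.B1 Ω₂)
    (lam₁ : ℕ → ℝ) (e₁ : ℕ → ProductDirichlet.H1 Ω₁)
    (lam₂ : ℕ → ℝ) (e₂ : ℕ → ProductDirichlet.H1 Ω₂)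
    (h₁ : ProductDirichlet.IsDirichletEigenbasis Ω₁ lam₁ e₁)
    (h₂ : ProductDirichlet.IsDirichletEigenbasis Ω₂ lam₂ e₂) :
    ∃ u : ℕ × ℕ → ProductDirichlet.H1 (ProductDirichlet.prodRegion Ω₁ Ω₂),
      (∀ j k, ProductDirichlet.IsDyad (u (j, k)) (e₁ j) (e₂ k)) ∧
      (∀ j k, ProductDirichlet.IsDirichletEigenfunction (ProductDirichlet.prodRegion Ω₁ Ω₂)
        (lam₁ j + lam₂ k) (u (j, k))) ∧
      ProductDirichlet.IsL2OrthonormalBasis u ∧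
      ProductDirichlet.IsGradOrthonormalBasis
        (fun p : ℕ × ℕ => (lam₁ p.1 + lam₂ p.2) ^ (-(1 / 2) : ℝ) • u p) ∧
      ∀ (lam : ℝ) (v : ProductDirichlet.H1 (ProductDirichlet.prodRegion Ω₁ Ω₂)),
        ProductDirichlet.IsDirichletEigenfunction (ProductDirichlet.prodRegion Ω₁ Ω₂) lam v →
        v ∈ Submodule.span ℝ (u '' {p : ℕ × ℕ | lam₁ p.1 + lam₂ p.2 = lam}) := by
  have : IsFiniteMeasure (volume.restrict Ω₁) :=
    isFiniteMeasure_restrict.mpr hΩ₁.isBounded.measure_lt_top.ne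
  have : IsFiniteMeasure (volume.restrict Ω₂) :=
    isFiniteMeasure_restrict.mpr hΩ₂.isBounded.measure_lt_top.ne
  have hΩ := isOpen_prodRegion hΩ₁.isOpen hΩ₂.isOpen
  have hex := fun p : ℕ × ℕ => exists_mem_H10_dyad (h₁.eigenfunction p.1).mem_H10
    (h₂.eigenfunction p.2).mem_H10
  choose u hu hut hug using hex
  have ho : Orthonormal ℝ fun p => toL2 (u p) := by
    rw [orthonormal_iff_ite]
    intro p q
    rw [hut, hut, inner_mulTensor_mulTensor, orthonormal_iff_ite.mp h₁.basis.orthonormal,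
      orthonormal_iff_ite.mp h₂.basis.orthonormal]
    by_cases h1 : p.1 = q.1 <;> by_cases h2 : p.2 = q.2 <;> simp [h1, h2, Prod.ext_iff]
  have hbasis : IsL2OrthonormalBasis u := by
    have hbot : (Submodule.span ℝ (Set.range fun p => toL2 (u p)))ᗮ = ⊥ := by
      rw [Submodule.eq_bot_iff]
      intro f hf
      obtain ⟨b₁, hb₁⟩ := h₁.basis
      obtain ⟨b₂, hb₂⟩ := h₂.basis
      refine eq_zero_of_forall_inner_mulTensor_eq_zero b₁ b₂ fun j k => ?_
      rw [hb₁, hb₂, ← hut (j, k)]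
      exact (Submodule.mem_orthogonal _ _).mp hf _ (Submodule.subset_span ⟨(j, k), rfl⟩)
    exact ⟨HilbertBasis.mkOfOrthogonalEqBot ho hbot, fun p => by
      rw [HilbertBasis.coe_mkOfOrthogonalEqBot]⟩
  have heig : ∀ p : ℕ × ℕ,
      IsDirichletEigenfunction (prodRegion Ω₁ Ω₂) (lam₁ p.1 + lam₂ p.2) (u p) := by
    intro p
    refine ⟨hu p, ho.ne_zero p, fun h hh => ?_⟩
    rw [integral_mul_eq_inner, hut, ← inner_dyadGrad_grad (h₁.eigenfunction p.1)
      (h₂.eigenfunction p.2) hh, ← hug, ← gradInner_eq_inner]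
    rfl
  have hpos₁ := eigenvalue_pos h₁.eigenfunction h₁.basis
  have hpos₂ := eigenvalue_pos h₂.eigenfunction h₂.basis
  refine ⟨u, fun j k => ?_, fun j k => heig (j, k), hbasis,
    isGradOrthonormalBasis_of_eigenbasis hΩ heig hbasis
      fun p => add_pos (hpos₁ p.1) (hpos₂ p.2), fun lam v hv => ?_⟩
  · rw [IsDyad, hut]
    exact coeFn_tensor _ _ _
  · refine mem_span_of_isDirichletEigenfunction hΩ heig hbasis ?_ hv
    -- All eigenvalues are nonnegative, so each of the two summands is at most their sum `lam`.
    refine ((finite_setOf_eigenvalue_le h₁.eigenfunction h₁.basis lam).prod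
      (finite_setOf_eigenvalue_le h₂.eigenfunction h₂.basis lam)).subset fun p hp => ⟨?_, ?_⟩
    · exact (le_add_of_nonneg_right (hpos₂ p.2).le).trans_eq hp
    · exact (le_add_of_nonneg_left (hpos₁ p.1).le).trans_eq hp
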